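/- A qustring of length $n$ is a unit vector of $(\mathbb{C}^2)^{\otimes n}$. It is $k$-separable if, after some permutation of its qubits, it is a tensor product of $k$ qustrings of length at least $1$; its separability index is the largest $k\le n$ for which it is $k$-separable, and it is partially entangled if its separability index is at most $n-1$. An ensemble of qustrings with size factor $\ell:\mathbb{N}\to\mathbb{N}$ is a sequence $\Xi=\{|\xi_n\rangle\}_{n\in\mathbb{N}}$ with $|\xi_n\rangle$ a qustring of length $\ell(n)$; it is an entanglement ensemble if $\ell$ is strictly increasing and every $|\xi_n\rangle$ is partially entangled. Let $\mathcal{G}$ be any finite set of quantum gates (unitary operators on finitely many qubits) containing the identity, the NOT gate and the standard universal set consisting of the Hadamard gate, the gate $T=\mathrm{diag}(1,e^{i\pi/4})$ and the Controlled-NOT gate. Quantum circuits are built from gates of $\mathcal{G}$, and the size of a circuit is its total number of gates. Write $\|X\|_{\mathrm{tr}}=\frac12\mathrm{Tr}\sqrt{X^\dagger X}$. A non-uniform $(\epsilon,s)$-approximator of an ensemble $\Xi$ with size factor $\ell$ is a family $\{C_n\}_{n\in\mathbb{N}}$ of quantum circuits, where $C_n$ has size at most $s(n)$, has $\ell(n)$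 input qubits and some number $p(n)\ge 0$ of ancilla qubits, such that for all but finitely many $n$ $$\bigl\|\mathrm{Tr}_{\mathcal{H}_n}\bigl(C_n|0^{p(n)+\ell(n)}\rangle\langle 0^{p(n)+\ell(n)}|C_n^\dagger\bigr)-|\xi_n\rangle\langle\xi_n|\bigr\|_{\mathrm{tr}}\le\epsilon(n),$$ where $\mathcal{H}_n$ is the Hilbert space of the ancilla qubits. $\Xi$ is $(\epsilon,s)$-approximable if it has such an approximator. Then: 1. For every function $\epsilon:\mathbb{N}\to(0,1]$, every ensemble of qustrings with size factor $n$ has a non-uniform $(\epsilon,s)$-approximator, where $$s(n)=n^2\,2^n\,\Bigl(\log_2\frac{n^2\,2^{2n}}{\epsilon(n)}\Bigr)^2 .$$ 2. For every constant $\epsilon$ with $0<\epsilon<1$ and every strictly increasing $\ell:\mathbb{N}\to\mathbb{N}$ with $\ell(0)\ge 2$, there is an entanglement ensemble with size factor $\ell$ that is not $(\epsilon,n^{O(1)})$-approximable, i.e. not $(\epsilon,s)$-approximable for any $s:\mathbb{N}\to\mathbb{N}$ with $s(n)=O(n^c)$ for some constant $c$. -/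

import Mathlib

open Matrix Filter Asymptotics

noncomputable section

namespace Qu

/-! ## Qustrings -/

/-- A qustring of length `n`: a unit vector of the `2 ^ n`-dimensional Hilbert space whose
standard basis is indexed by the binary strings of length `n`. -/
def Qustring (n : ℕ) : Type :=
  {v : EuclideanSpace ℂ (Fin n → Bool) // ‖v‖ = 1}

/-- The amplitude of the basis string `x` in the qustring `φ`. -/
def Qustring.amp {n : ℕ} (φ : Qustring n) (x : Fin n → Bool) : ℂ := φ.1 x

/-- The rank-one matrix `|v⟩⟨v|`. -/
def ketbra {X : Type} (v : X → ℂ) : Matrix X X ℂ := Matrix.vecMulVec v (star v)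

/-- The trace norm `(1/2) Tr √(Xᴴ X)` (with the factor `1/2`). -/
def trNorm {X : Type} [Fintype X] [DecidableEq X] (A : Matrix X X ℂ) : ℝ :=
  (1 / 2) * (Matrix.trace (cfc Real.sqrt (Aᴴ * A))).re

/-! ## Separability index and entanglement ensembles -/

/-- The amplitude at `y` of the tensor product `φ₁ ⊗ ⋯ ⊗ φₖ` of qustrings of lengths
`m₁, …, mₖ` with total length `n`: the string `y` is cut into consecutive blocks of lengths
`m₁, …, mₖ`. -/
def tensorAmp {n k : ℕ} {m : Fin k → ℕ} (hm : ∑ j, m j = n) (φ : ∀ j, Qustring (m j))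
    (y : Fin n → Bool) : ℂ :=
  ∏ j, (φ j).amp (fun i => y (Fin.cast hm (finSigmaFinEquiv ⟨j, i⟩)))

/-- `ξ` is `k`-separable: for some permutation `σ` of its qubits, `σ(ξ)` is a tensor product of
`k` qustrings of length at least one.  Here `σ(ξ) = ∑ₓ αₓ |x_{σ(1)} ⋯ x_{σ(n)}⟩` when
`ξ = ∑ₓ αₓ |x⟩`, so the amplitude of `σ(ξ)` at `x ∘ σ` is the amplitude of `ξ` at `x`. -/
def KSeparable {n : ℕ} (k : ℕ) (ξ : Qustring n) : Prop :=
  ∃ (m : Fin k → ℕ) (hm : ∑ j, m j = n) (φ : ∀ j, Qustring (m j)) (σ : Equiv.Perm (Fin n)),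
    (∀ j, 1 ≤ m j) ∧ ∀ x : Fin n → Bool, ξ.amp x = tensorAmp hm φ (x ∘ σ)

open Classical in
/-- The separability index: the largest `k ≤ n` such that `ξ` is `k`-separable. -/
def sind {n : ℕ} (ξ : Qustring n) : ℕ := Nat.findGreatest (fun k => KSeparable k ξ) n

/-- Partially entangled: the separability index is at most `n - 1`. -/
def PartiallyEntangled {n : ℕ} (ξ : Qustring n) : Prop := sind ξ + 1 ≤ n

/-- A series of qustrings `ξ n` of length `ℓ n` is an entanglement ensemble with size factor `ℓ`. -/
def IsEntanglementEnsemble (ℓ : ℕ → ℕ) (ξ : ∀ n, Qustring (ℓ n)) : Prop :=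
  StrictMono ℓ ∧ ∀ n, PartiallyEntangled (ξ n)

/-! ## Quantum gates and quantum circuits -/

/-- A quantum gate: a unitary matrix acting on `arity` qubits. -/
structure Gate where
  arity : ℕ
  mat : Matrix.unitaryGroup (Fin arity → Bool) ℂ

/-- A gate of the set `G` together with the distinct wires of the circuit it is applied to. -/
structure PlacedGate (G : Set Gate) (ι : Type) where
  gate : Gate
  mem : gate ∈ G
  wires : Fin gate.arity ↪ ι

open Classical in
/-- The action of a placed gate on the whole register: the gate acts on its own wires, and the
identity acts on all the other ones. -/
def PlacedGate.toMatrix {G : Set Gate} {ι : Type} (g : PlacedGate G ι) :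
    Matrix (ι → Bool) (ι → Bool) ℂ :=
  Matrix.of fun x y =>
    if ∀ i, i ∉ Set.range g.wires → x i = y i then
      (g.gate.mat : Matrix _ _ ℂ) (x ∘ g.wires) (y ∘ g.wires)
    else 0

/-- A quantum circuit over the gate set `G` with wires `ι`: the list of its placed gates, the first
one being applied first. -/
def Circuit (G : Set Gate) (ι : Type) : Type := List (PlacedGate G ι)

/-- The size of a circuit is the total number of its gates. -/
def Circuit.size {G : Set Gate} {ι : Type} (C : Circuit G ι) : ℕ := List.length C

/-- The operator computed by a circuit. -/
def Circuit.toMatrix {G : Set Gate} {ι : Type} [Fintype ι] [DecidableEq ι] :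
    Circuit G ι → Matrix (ι → Bool) (ι → Bool) ℂ
  | [] => 1
  | g :: C => Circuit.toMatrix (G := G) (ι := ι) C * g.toMatrix

/-- The basis state `|0 ⋯ 0⟩`. -/
def ketZero (ι : Type) [Fintype ι] [DecidableEq ι] : (ι → Bool) → ℂ :=
  Pi.single (fun _ => false) 1

/-- The partial trace over the qubits in `B`. -/
def partialTrace {A B : Type} [Fintype B] [DecidableEq B]
    (M : Matrix (A ⊕ B → Bool) (A ⊕ B → Bool) ℂ) :
    Matrix (A → Bool) (A → Bool) ℂ :=
  Matrix.of fun x y => ∑ b : B → Bool, M (Sum.elim x b) (Sum.elim y b)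

/-- The mixed state of the `A`-wires after the circuit has been run on `|0 ⋯ 0⟩` and the ancilla
wires `B` have been traced out. -/
def Circuit.output {G : Set Gate} {A B : Type} [Fintype A] [DecidableEq A] [Fintype B]
    [DecidableEq B] (C : Circuit G (A ⊕ B)) : Matrix (A → Bool) (A → Bool) ℂ :=
  partialTrace (C.toMatrix * ketbra (ketZero (A ⊕ B)) * C.toMatrixᴴ)

/-- `C` is a non-uniform `ε`-approximator, of size at most `s`, of the ensemble `ξ` with size
factor `ℓ`; the `n`-th circuit has `ℓ n` input qubits and `p n` ancilla qubits. -/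
def IsApproximator (G : Set Gate) (ℓ : ℕ → ℕ) (ξ : ∀ n, Qustring (ℓ n)) (ε s : ℕ → ℝ)
    (p : ℕ → ℕ) (C : ∀ n, Circuit G (Fin (ℓ n) ⊕ Fin (p n))) : Prop :=
  (∀ n, ((C n).size : ℝ) ≤ s n) ∧
    ∀ᶠ n in atTop, trNorm ((C n).output - ketbra (ξ n).amp) ≤ ε n

/-- The ensemble `ξ` with size factor `ℓ` is non-uniformly `(ε, s)`-approximable. -/
def Approximable (G : Set Gate) (ℓ : ℕ → ℕ) (ξ : ∀ n, Qustring (ℓ n)) (ε s : ℕ → ℝ) : Prop :=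
  ∃ (p : ℕ → ℕ) (C : ∀ n, Circuit G (Fin (ℓ n) ⊕ Fin (p n))), IsApproximator G ℓ ξ ε s p C

/-! ## The standard universal gate set -/

lemma sum_fin_one (f : (Fin 1 → Bool) → ℂ) :
    ∑ x, f x = f (fun _ => true) + f (fun _ => false) := by
  rw [← (Equiv.funUnique (Fin 1) Bool).symm.sum_comp]
  simp [Equiv.funUnique]
  rfl

lemma fin_one_cases (x : Fin 1 → Bool) : x = (fun _ => true) ∨ x = (fun _ => false) := by
  revert x; decide

/-- The matrix of the NOT gate. -/
def notMat : Matrix (Fin 1 → Bool) (Fin 1 → Bool) ℂ :=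
  Matrix.of fun x y => if x 0 = !(y 0) then 1 else 0

/-- The matrix of the Hadamard gate. -/
def hadamardMat : Matrix (Fin 1 → Bool) (Fin 1 → Bool) ℂ :=
  Matrix.of fun x y => (if x 0 && y 0 then -1 else 1) / (Real.sqrt 2 : ℂ)

/-- The matrix of the `π/8` gate, `T = diag(1, e^{iπ/4})`. -/
def tMat : Matrix (Fin 1 → Bool) (Fin 1 → Bool) ℂ :=
  Matrix.diagonal fun x => if x 0 then Complex.exp (Complex.I * (Real.pi / 4)) else 1

/-- The matrix of the Controlled-NOT gate, `|a, b⟩ ↦ |a, a ⊕ b⟩`. -/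
def cnotMat : Matrix (Fin 2 → Bool) (Fin 2 → Bool) ℂ :=
  Matrix.of fun x y => if x 0 = y 0 ∧ x 1 = xor (y 0) (y 1) then 1 else 0

lemma notMat_mem : notMat ∈ Matrix.unitaryGroup (Fin 1 → Bool) ℂ := by
  rw [Matrix.mem_unitaryGroup_iff]
  ext x y
  rw [Matrix.mul_apply, sum_fin_one]
  rcases fin_one_cases x with rfl | rfl <;> rcases fin_one_cases y with rfl | rfl <;>
    simp [notMat, funext_iff]

lemma hadamardMat_mem : hadamardMat ∈ Matrix.unitaryGroup (Fin 1 → Bool) ℂ := by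
  have h : ((Real.sqrt 2 : ℝ) : ℂ)⁻¹ * ((Real.sqrt 2 : ℝ) : ℂ)⁻¹ = 1 / 2 := by
    rw [← mul_inv, ← Complex.ofReal_mul, Real.mul_self_sqrt (by norm_num)]
    norm_num
  rw [Matrix.mem_unitaryGroup_iff]
  ext x y
  rw [Matrix.mul_apply, sum_fin_one]
  rcases fin_one_cases x with rfl | rfl <;> rcases fin_one_cases y with rfl | rfl <;>
    simp [hadamardMat, funext_iff, div_eq_mul_inv, h] <;> norm_num

lemma tMat_mem : tMat ∈ Matrix.unitaryGroup (Fin 1 → Bool) ℂ := by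
  rw [Matrix.mem_unitaryGroup_iff, tMat, Matrix.star_eq_conjTranspose,
    Matrix.diagonal_conjTranspose, Matrix.diagonal_mul_diagonal, ← Matrix.diagonal_one]
  congr 1
  funext x
  by_cases hx : x 0
  · simp [hx, ← Complex.exp_conj, ← Complex.exp_add, Complex.conj_ofNat]
  · simp [hx]

lemma cnotMat_mem : cnotMat ∈ Matrix.unitaryGroup (Fin 2 → Bool) ℂ := by
  rw [Matrix.mem_unitaryGroup_iff]
  ext x y
  rw [Matrix.mul_apply, Finset.sum_eq_single (fun i => if i = 0 then x 0 else xor (x 0) (x 1))]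
  · have : x = y ↔ (y 0 = x 0 ∧ y 1 = x 1) := by
      rw [funext_iff, Fin.forall_fin_two]; tauto
    by_cases h : x = y
    · subst h; simp [cnotMat]
    · rw [Matrix.one_apply_ne h]
      rw [this] at h
      simpa [cnotMat] using h
  · intro z _ hz
    have : ¬ (x 0 = z 0 ∧ x 1 = xor (z 0) (z 1)) := by
      rintro ⟨h0, h1⟩
      apply hz
      funext i
      fin_cases i
      · simp [h0]
      · simp [h0, h1]
    simp only [cnotMat, Matrix.of_apply, if_neg this, zero_mul]
  · simp

/-- The identity gate on one qubit. -/
def idGate : Gate := ⟨1, 1⟩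

/-- The NOT gate. -/
def notGate : Gate := ⟨1, ⟨notMat, notMat_mem⟩⟩

/-- The Hadamard gate. -/
def hadamardGate : Gate := ⟨1, ⟨hadamardMat, hadamardMat_mem⟩⟩

/-- The `π/8` gate. -/
def tGate : Gate := ⟨1, ⟨tMat, tMat_mem⟩⟩

/-- The Controlled-NOT gate. -/
def cnotGate : Gate := ⟨2, ⟨cnotMat, cnotMat_mem⟩⟩

/-- The standard universal gate set, together with the identity and the NOT gate. -/
def standardGates : Set Gate := {idGate, notGate, hadamardGate, tGate, cnotGate}

end Qu

end

noncomputable section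

namespace Qu

set_option linter.unusedSectionVars false

/-! ## Matrices acting on some of the wires -/

/-! Lower bound (statement 2). A circuit with S gates of arity at most r meets at most rS ancillas,
so however many ancillas are allowed, its output is one of at most (|G|(N+rS)^r+1)^S = 2^O(NS)
density matrices. Against these stand 2^(md) states, m = ⌊N/2⌋: the graph states 2^(-m/2) ∑ₐ |a⟩|f
a⟩ with f = X^d + P, deg P < d, over the field with 2^m elements. Two such polynomials agree at
fewer than d points, so overlaps are at most d/2^m. A mixed output within 1-δ of a state has
fidelity at least δ with it, and a Bessel inequality for almost orthogonal families
(`sum_norm_inner_sq_le`) leaves at most 2/δ such states per output. With d about (δ/2)2^m and S =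
2^(N/8) the states outnumber the outputs. They are entangled since the support of a completely
separable state is closed under bitwise mixing, unlike the graph of a nonconstant f.

Upper bound (statement 1). Unit vectors with entries in ℤ[i]/√2^k are prepared exactly
(`prep_gaussVec`), so each gate need not be approximated separately. Call a Gaussian integer odd if
1+i does not divide it. The squared norms add up to 2^k, so for k > 0 the number of odd entries is
even. A square root of NOT between two basis strings, after a phase i on one of them if needed,
makes two odd entries even; once all are even, divide by 1+i and lower k. Each move is a multiply
controlled phase i, built from Toffoli gates with clean ancillas, conjugated by cheap gates, and
costs O(n).

For arbitrary ξ, round 2^κ ξ towards zero to Gaussian integers. The missing squared norm is an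
integer, by the four-square theorem the norm of a Gaussian integer vector; it goes into the branch
where an extra qubit is 1. Tracing that qubit out leaves an error of at most 4·8^n/2^κ
(`exists_circuit_approx`), so κ ≈ 3n + 2 + log₂(1/ε) suffices, and O(n 2^n κ) gates fit the stated
size for n ≥ 20. -/

open Classical in
/-- The matrix acting as `M` on the wires in the range of `w` and as the identity on the others. -/
def lift {κ ι : Type} (w : κ ↪ ι) (M : Matrix (κ → Bool) (κ → Bool) ℂ) :
    Matrix (ι → Bool) (ι → Bool) ℂ :=
  Matrix.of fun x y => if ∀ i, i ∉ Set.range w → x i = y i then M (x ∘ w) (y ∘ w) else 0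

lemma toMatrix_eq_lift {G : Set Gate} {ι : Type} (g : PlacedGate G ι) :
    g.toMatrix = lift g.wires (g.gate.mat : Matrix _ _ ℂ) := rfl

section lift

variable {κ ι : Type}

lemma extend_comp_emb (w : κ ↪ ι) (u : κ → Bool) (x : ι → Bool) :
    Function.extend w u x ∘ w = u := by
  funext k; exact w.injective.extend_apply u x k

lemma extend_of_agree (w : κ ↪ ι) {x y : ι → Bool}
    (h : ∀ i, i ∉ Set.range w → x i = y i) : Function.extend w (y ∘ w) x = y := by
  funext i
  by_cases hi : i ∈ Set.range w
  · obtain ⟨k, rfl⟩ := hi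
    exact w.injective.extend_apply _ _ k
  · rw [Function.extend_apply' _ _ _ (fun ⟨k, hk⟩ => hi ⟨k, hk⟩)]
    exact h i hi

-- The strings agreeing with `x` off the range of `w` are exactly the extensions of strings on κ, so
-- a row of a lifted matrix reduces to a sum over κ.
open Classical in
lemma sum_agree [Fintype κ] [DecidableEq κ] [Fintype ι] [DecidableEq ι] (w : κ ↪ ι)
    (x : ι → Bool) (f : (ι → Bool) → ℂ) :
    ∑ y, (if ∀ i, i ∉ Set.range w → x i = y i then f y else 0)
      = ∑ u : κ → Bool, f (Function.extend w u x) := by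
  rw [← Finset.sum_filter]
  refine Finset.sum_nbij' (fun y => y ∘ w) (fun u => Function.extend w u x) ?_ ?_ ?_ ?_ ?_
  · simp
  · intro u _
    simp only [Finset.mem_filter, Finset.mem_univ, true_and]
    intro i hi
    rw [Function.extend_apply' _ _ _ (fun ⟨k, hk⟩ => hi ⟨k, hk⟩)]
  · intro y hy
    exact extend_of_agree w (by simpa using hy)
  · intro u _; exact extend_comp_emb w u x
  · intro y hy
    rw [extend_of_agree w (by simpa using hy)]

lemma lift_mulVec [Fintype κ] [DecidableEq κ] [Fintype ι] [DecidableEq ι] (w : κ ↪ ι)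
    (M : Matrix (κ → Bool) (κ → Bool) ℂ) (ψ : (ι → Bool) → ℂ) (x : ι → Bool) :
    (lift w M *ᵥ ψ) x = ∑ u, M (x ∘ w) u * ψ (Function.extend w u x) := by
  classical
  simp only [Matrix.mulVec, dotProduct, lift, Matrix.of_apply, ite_mul, zero_mul]
  rw [sum_agree w x (fun y => M (x ∘ w) (y ∘ w) * ψ y)]
  simp [extend_comp_emb]

lemma lift_one [DecidableEq κ] [Fintype κ] [DecidableEq ι] [Fintype ι] (w : κ ↪ ι) :
    lift w (1 : Matrix (κ → Bool) (κ → Bool) ℂ) = 1 := by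
  classical
  ext x y
  simp only [lift, Matrix.of_apply]
  by_cases h : x = y
  · subst h; simp
  · rw [Matrix.one_apply_ne h]
    split_ifs with h'
    · apply Matrix.one_apply_ne
      intro h2
      apply h
      rw [← extend_of_agree w h', ← h2]
      exact (extend_of_agree w (fun _ _ => rfl)).symm
    · rfl

lemma lift_mul [Fintype κ] [DecidableEq κ] [Fintype ι] [DecidableEq ι] (w : κ ↪ ι)
    (M N : Matrix (κ → Bool) (κ → Bool) ℂ) : lift w (M * N) = lift w M * lift w N := by
  classical
  ext x y
  have h := lift_mulVec w M (fun z => lift w N z y) x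
  have h1 : (lift w M * lift w N) x y = (lift w M *ᵥ fun z => lift w N z y) x := rfl
  rw [h1, h]
  simp only [lift, Matrix.of_apply, Matrix.mul_apply, extend_comp_emb]
  have h2 : ∀ u : κ → Bool, (∀ i, i ∉ Set.range w → Function.extend w u x i = y i) ↔
      (∀ i, i ∉ Set.range w → x i = y i) := by
    intro u
    refine forall_congr' fun i => forall_congr' fun hi => ?_
    rw [Function.extend_apply' _ _ _ (fun ⟨k, hk⟩ => hi ⟨k, hk⟩)]
  simp only [h2]
  split_ifs <;> simp

lemma lift_conjTranspose (w : κ ↪ ι) (M : Matrix (κ → Bool) (κ → Bool) ℂ) :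
    (lift w M)ᴴ = lift w Mᴴ := by
  classical
  ext x y
  simp only [lift, Matrix.of_apply, Matrix.conjTranspose_apply, eq_comm]
  split_ifs <;> simp

lemma lift_lift {μ : Type} (e : ι ↪ μ) (w : κ ↪ ι) (M : Matrix (κ → Bool) (κ → Bool) ℂ) :
    lift (w.trans e) M = lift e (lift w M) := by
  classical
  ext x y
  simp only [lift, Matrix.of_apply]
  by_cases h : ∀ i, i ∉ Set.range (w.trans e) → x i = y i
  · rw [if_pos h, if_pos, if_pos]
    · rfl
    · intro i hi
      exact h _ (by rintro ⟨k, hk⟩; exact hi ⟨k, e.injective hk⟩)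
    · intro i hi
      exact h _ (by rintro ⟨k, hk⟩; exact hi ⟨w k, hk⟩)
  · rw [if_neg h]
    split_ifs with h1 h2
    · exfalso
      apply h
      intro i hi
      by_cases h3 : i ∈ Set.range e
      · obtain ⟨j, rfl⟩ := h3
        exact h2 j (by rintro ⟨k, rfl⟩; exact hi ⟨k, rfl⟩)
      · exact h1 i h3
    · rfl
    · rfl

end lift

/-! ## Circuits -/

section circuit

variable {G : Set Gate} {ι : Type} [Fintype ι] [DecidableEq ι]

lemma PlacedGate.conjTranspose_mul_self (g : PlacedGate G ι) : g.toMatrixᴴ * g.toMatrix = 1 := by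
  rw [toMatrix_eq_lift, lift_conjTranspose, ← lift_mul, ← Matrix.star_eq_conjTranspose,
    Unitary.coe_star_mul_self, lift_one]

lemma Circuit.toMatrix_nil : Circuit.toMatrix (G := G) (ι := ι) [] = 1 := rfl

lemma Circuit.toMatrix_cons (g : PlacedGate G ι) (C : List (PlacedGate G ι)) :
    Circuit.toMatrix (G := G) (ι := ι) (g :: C) = Circuit.toMatrix (G := G) C * g.toMatrix := rfl

lemma Circuit.toMatrix_append (C D : List (PlacedGate G ι)) :
    Circuit.toMatrix (G := G) (ι := ι) (C ++ D)
      = Circuit.toMatrix (G := G) D * Circuit.toMatrix (G := G) C := by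
  induction C with
  | nil => simp [Circuit.toMatrix_nil]
  | cons g C ih => rw [List.cons_append, Circuit.toMatrix_cons, ih, Circuit.toMatrix_cons,
      Matrix.mul_assoc]

lemma Circuit.conjTranspose_mul_self (C : Circuit G ι) : C.toMatrixᴴ * C.toMatrix = 1 := by
  induction C with
  | nil => rw [Circuit.toMatrix_nil]; simp
  | cons g C ih =>
    rw [Circuit.toMatrix_cons, Matrix.conjTranspose_mul, Matrix.mul_assoc,
      ← Matrix.mul_assoc _ (Circuit.toMatrix C), ih, Matrix.one_mul, g.conjTranspose_mul_self]

/-- The pure state computed by a circuit from `|0 ⋯ 0⟩`. -/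
def Circuit.state (C : Circuit G ι) : (ι → Bool) → ℂ := C.toMatrix *ᵥ ketZero ι

lemma Circuit.sum_normSq_state (C : Circuit G ι) : ∑ x, Complex.normSq (C.state x) = 1 := by
  have h : star C.state ⬝ᵥ C.state = 1 := by
    rw [Circuit.state, Matrix.star_mulVec, ← Matrix.dotProduct_mulVec, Matrix.mulVec_mulVec,
      C.conjTranspose_mul_self, Matrix.one_mulVec, ketZero]
    simp
  have h2 : ((∑ x, Complex.normSq (C.state x) : ℝ) : ℂ) = 1 := by
    rw [← h, dotProduct]
    push_cast
    refine Finset.sum_congr rfl fun x _ => ?_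
    rw [Complex.normSq_eq_conj_mul_self]; rfl
  exact_mod_cast h2

lemma mul_ketbra_mul {X : Type} [Fintype X] [DecidableEq X] (M : Matrix X X ℂ) (v : X → ℂ) :
    M * ketbra v * Mᴴ = ketbra (M *ᵥ v) := by
  rw [ketbra, ketbra, Matrix.mul_vecMulVec, Matrix.vecMulVec_mul, Matrix.star_mulVec]

lemma Circuit.output_apply {A B : Type} [Fintype A] [DecidableEq A] [Fintype B] [DecidableEq B]
    (C : Circuit G (A ⊕ B)) (x y : A → Bool) :
    C.output x y = ∑ b : B → Bool, C.state (Sum.elim x b) * star (C.state (Sum.elim y b)) := by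
  rw [Circuit.output, mul_ketbra_mul]
  rfl

end circuit

/-! ## The trace norm of a Hermitian matrix -/

section trNorm

variable {X : Type} [Fintype X] [DecidableEq X]

/-- For Hermitian A, AᴴA = A² and √(x²) = |x| in the functional calculus. -/
lemma trNorm_eq_sum_abs_eigenvalues {A : Matrix X X ℂ} (hA : A.IsHermitian) :
    trNorm A = (1 / 2) * ∑ i, |hA.eigenvalues i| := by
  have hsa : IsSelfAdjoint A := hA
  have h1 : cfc Real.sqrt (Aᴴ * A) = cfc (fun x : ℝ => |x|) A := by
    have : Aᴴ * A = cfc (fun x : ℝ => x ^ 2) A := by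
      rw [cfc_pow_id A 2 hsa, hA.eq, sq]
    rw [this, ← cfc_comp Real.sqrt (fun x : ℝ => x ^ 2) A (ha := hsa)
      (hg := Real.continuous_sqrt.continuousOn) (hf := by fun_prop)]
    congr 1
    funext x
    exact Real.sqrt_sq_eq_abs x
  rw [trNorm, h1, hA.cfc_eq, Matrix.IsHermitian.cfc]
  congr 1
  rw [Unitary.conjStarAlgAut_apply, Matrix.trace_mul_comm, ← Matrix.mul_assoc,
    Unitary.coe_star_mul_self, Matrix.one_mul, Matrix.trace_diagonal, Complex.re_sum]
  simp

/-- The trace norm is at most `√|X| / 2` times the Hilbert–Schmidt norm. -/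
lemma trNorm_le_of_sum_le {A : Matrix X X ℂ} (hA : A.IsHermitian) {c : ℝ}
    (hc : 0 ≤ c) (h : Fintype.card X * ∑ x, ∑ y, ‖A x y‖ ^ 2 ≤ (2 * c) ^ 2) : trNorm A ≤ c := by
  have h1 : ∑ i, (hA.eigenvalues i) ^ 2 = ∑ x, ∑ y, ‖A x y‖ ^ 2 := by
    have h2 : (A * A).trace = ((∑ i, (hA.eigenvalues i) ^ 2 : ℝ) : ℂ) := by
      conv_lhs => rw [hA.spectral_theorem]
      rw [← map_mul, Unitary.conjStarAlgAut_apply, Matrix.trace_mul_comm, ← Matrix.mul_assoc,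
        Unitary.coe_star_mul_self, Matrix.one_mul, Matrix.diagonal_mul_diagonal,
        Matrix.trace_diagonal]
      push_cast
      refine Finset.sum_congr rfl fun i _ => ?_
      simp [sq]
    have h3 : (A * A).trace = ((∑ x, ∑ y, ‖A x y‖ ^ 2 : ℝ) : ℂ) := by
      conv_lhs => rw [← hA.eq]
      conv_lhs => enter [1, 2]; rw [hA.eq]
      rw [Matrix.trace, Finset.sum_comm]
      push_cast
      refine Finset.sum_congr rfl fun x _ => ?_
      rw [Matrix.diag_apply, Matrix.mul_apply]
      refine Finset.sum_congr rfl fun y _ => ?_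
      rw [Matrix.conjTranspose_apply, ← Complex.conj_mul']; rfl
    exact_mod_cast h2.symm.trans h3
  -- Cauchy–Schwarz on the eigenvalues, whose squares sum to Tr A².
  have h4 : (∑ i, |hA.eigenvalues i|) ^ 2 ≤ (2 * c) ^ 2 := by
    refine le_trans ?_ h
    rw [← h1]
    have := sq_sum_le_card_mul_sum_sq (s := Finset.univ) (f := fun i => |hA.eigenvalues i|)
    simpa using this
  rw [trNorm_eq_sum_abs_eigenvalues hA]
  have := abs_le_of_sq_le_sq' h4 (by positivity)
  linarith [this.2]

/-- A traceless Hermitian matrix has trace norm at least `-⟨v|A|v⟩`. -/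
lemma neg_expectation_le_trNorm {A : Matrix X X ℂ} (hA : A.IsHermitian) (htr : A.trace = 0)
    (v : EuclideanSpace ℂ X) (hv : ‖v‖ = 1) :
    -(star (v : X → ℂ) ⬝ᵥ (A *ᵥ (v : X → ℂ))).re ≤ trNorm A := by
  have h1 : ∑ i, hA.eigenvalues i = 0 := by
    have := hA.trace_eq_sum_eigenvalues
    rw [htr] at this
    apply Complex.ofReal_injective
    rw [Complex.ofReal_sum, Complex.ofReal_zero, this]
    rfl
  have h2 : (star (v : X → ℂ) ⬝ᵥ (A *ᵥ (v : X → ℂ))).re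
      = ∑ i, hA.eigenvalues i * ‖inner ℂ (hA.eigenvectorBasis i) v‖ ^ 2 := by
    have e1 : star (v : X → ℂ) ⬝ᵥ (A *ᵥ (v : X → ℂ)) = inner ℂ v (WithLp.toLp 2 (A *ᵥ (v : X → ℂ))) := by
      rw [EuclideanSpace.inner_eq_star_dotProduct, dotProduct_comm]
    rw [e1, ← hA.eigenvectorBasis.sum_inner_mul_inner, Complex.re_sum]
    refine Finset.sum_congr rfl fun i _ => ?_
    have e2 : inner ℂ (hA.eigenvectorBasis i) (WithLp.toLp 2 (A *ᵥ (v : X → ℂ)))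
        = (hA.eigenvalues i : ℂ) * inner ℂ (hA.eigenvectorBasis i) v := by
      rw [EuclideanSpace.inner_eq_star_dotProduct, EuclideanSpace.inner_eq_star_dotProduct]
      simp only
      have e3 : star (hA.eigenvectorBasis i : X → ℂ) ᵥ* A
          = star (A *ᵥ (hA.eigenvectorBasis i : X → ℂ)) := by
        rw [Matrix.star_mulVec, hA.eq]
      rw [dotProduct_comm, Matrix.dotProduct_mulVec, e3,
        hA.mulVec_eigenvectorBasis, star_smul, smul_dotProduct, dotProduct_comm]
      simp
    rw [e2, ← inner_conj_symm v]
    rw [show ∀ a b : ℂ, (starRingEnd ℂ) a * (b * a) = b * ((starRingEnd ℂ) a * a) by intros; ring,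
      Complex.conj_mul', Complex.re_ofReal_mul]
    norm_cast
  rw [h2, trNorm_eq_sum_abs_eigenvalues hA]
  -- For weights 0 ≤ q ≤ 1, -λq is at most the negative part (|λ|-λ)/2; since ∑λ = 0, the negative
  -- parts sum to ½∑|λ|.
  have h3 : ∀ i, -(hA.eigenvalues i * ‖inner ℂ (hA.eigenvectorBasis i) v‖ ^ 2)
      ≤ (1 / 2) * (|hA.eigenvalues i| - hA.eigenvalues i) := by
    intro i
    have hw : ‖inner ℂ (hA.eigenvectorBasis i) v‖ ≤ 1 := by
      refine (norm_inner_le_norm _ _).trans ?_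
      rw [hv, hA.eigenvectorBasis.norm_eq_one]; norm_num
    have hw2 : ‖inner ℂ (hA.eigenvectorBasis i) v‖ ^ 2 ≤ 1 := pow_le_one₀ (norm_nonneg _) hw
    have hw3 := sq_nonneg ‖inner ℂ (hA.eigenvectorBasis i) v‖
    rcases abs_cases (hA.eigenvalues i) with ⟨h, h'⟩ | ⟨h, h'⟩ <;> rw [h] <;> nlinarith
  rw [← Finset.sum_neg_distrib]
  refine (Finset.sum_le_sum fun i _ => h3 i).trans ?_
  rw [← Finset.mul_sum, Finset.sum_sub_distrib, h1, sub_zero]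

end trNorm

/-! ## Relabelling the wires of a circuit, and counting circuits -/

section relabel

variable {G : Set Gate} {ι μ : Type}

/-- A placed gate moved along an embedding of the wires. -/
def PlacedGate.map (e : ι ↪ μ) (g : PlacedGate G ι) : PlacedGate G μ :=
  ⟨g.gate, g.mem, g.wires.trans e⟩

/-- A circuit moved along an embedding of the wires. -/
def Circuit.map (e : ι ↪ μ) (C : Circuit G ι) : Circuit G μ := List.map (PlacedGate.map e) C

lemma Circuit.size_map (e : ι ↪ μ) (C : Circuit G ι) : (C.map e).size = C.size :=
  List.length_map _

lemma Circuit.toMatrix_map [Fintype ι] [DecidableEq ι] [Fintype μ] [DecidableEq μ] (e : ι ↪ μ)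
    (C : Circuit G ι) : (C.map e).toMatrix = lift e C.toMatrix := by
  induction C with
  | nil => exact (lift_one e).symm
  | cons g C ih =>
    change (Circuit.map e C).toMatrix * (g.map e).toMatrix = _
    rw [ Circuit.toMatrix_cons, lift_mul, ih,
      toMatrix_eq_lift, toMatrix_eq_lift, ← lift_lift]
    rfl

-- Wires outside the range of `e` are never touched, so they keep their initial bit 0.
open Classical in
lemma Circuit.state_map [Fintype ι] [DecidableEq ι] [Fintype μ] [DecidableEq μ] (e : ι ↪ μ)
    (C : Circuit G ι) (z : μ → Bool) :
    (C.map e).state z =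
      if ∀ i, i ∉ Set.range e → false = z i then C.state (z ∘ e) else 0 := by
  have h : ∀ u : ι → Bool, Function.extend e u z = (fun _ => false) ↔
      u = (fun _ => false) ∧ ∀ i, i ∉ Set.range e → false = z i := by
    intro u
    constructor
    · intro h
      refine ⟨?_, fun i hi => ?_⟩
      · rw [← extend_comp_emb e u z, h]; rfl
      · rw [← congrFun h i, Function.extend_apply' _ _ _ (fun ⟨k, hk⟩ => hi ⟨k, hk⟩)]
    · rintro ⟨rfl, h⟩
      funext i
      by_cases hi : i ∈ Set.range e
      · obtain ⟨k, rfl⟩ := hi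
        exact e.injective.extend_apply _ _ k
      · rw [Function.extend_apply' _ _ _ (fun ⟨k, hk⟩ => hi ⟨k, hk⟩), ← h i hi]
  rw [Circuit.state, C.toMatrix_map, lift_mulVec]
  simp only [ketZero, Pi.single_apply, h, ite_and]
  split_ifs with h1
  · simp [Circuit.state, ketZero, Matrix.mulVec, dotProduct, Pi.single_apply]
  · simp

/-- Idle ancillas stay at 0 and contribute a single term to the partial trace. This is what allows
the ancilla register to be resized. -/
lemma Circuit.output_map {A B B' : Type} [Fintype A] [DecidableEq A] [Fintype B] [DecidableEq B]
    [Fintype B'] [DecidableEq B'] (f : B ↪ B') (C : Circuit G (A ⊕ B)) :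
    (C.map (Function.Embedding.sumMap (.refl A) f)).output = C.output := by
  classical
  ext x y
  rw [Circuit.output_apply, Circuit.output_apply]
  have h : ∀ b : B' → Bool, ∀ x : A → Bool,
      (∀ i, i ∉ Set.range (Function.Embedding.sumMap (.refl A) f) → false = Sum.elim x b i) ↔
        ∀ i, i ∉ Set.range f → false = b i := by
    intro b x
    constructor
    · intro h i hi
      refine h (Sum.inr i) ?_
      rintro ⟨j | j, hj⟩
      · simp at hj
      · exact hi ⟨j, by simpa using hj⟩
    · rintro h (i | i) hi
      · exact absurd ⟨Sum.inl i, rfl⟩ hi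
      · exact h i fun ⟨j, hj⟩ => hi ⟨Sum.inr j, by simp [hj]⟩
  have h2 : ∀ b : B' → Bool, ∀ x : A → Bool,
      Sum.elim x b ∘ (Function.Embedding.sumMap (.refl A) f) = Sum.elim x (b ∘ f) := by
    intro b x; funext i; rcases i with i | i <;> rfl
  simp only [Circuit.state_map, h, h2]
  rw [← Finset.sum_congr rfl fun b _ => congrArg₂ (· * star ·)
    (congrArg (fun t => C.state (Sum.elim x t)) (extend_comp_emb f b fun _ => false))
    (congrArg (fun t => C.state (Sum.elim y t)) (extend_comp_emb f b fun _ => false)),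
    ← sum_agree f (fun _ => false) (fun b => C.state (Sum.elim x (b ∘ f)) *
      star (C.state (Sum.elim y (b ∘ f))))]
  refine Finset.sum_congr rfl fun b _ => ?_
  split_ifs <;> simp

/-- Each gate meets at most `r` wires. The bound does not involve the size of `B`, so the later
count is uniform in the number of ancillas. -/
lemma exists_used_ancillas {A B : Type} {r : ℕ} (hr : ∀ g ∈ G, g.arity ≤ r)
    (C : List (PlacedGate G (A ⊕ B))) :
    ∃ U : Finset B, U.card ≤ r * C.length ∧
      ∀ g ∈ C, ∀ k b, g.wires k = Sum.inr b → b ∈ U := by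
  classical
  induction C with
  | nil => exact ⟨∅, by simp⟩
  | cons g C ih =>
    obtain ⟨U, hU, hU'⟩ := ih
    refine ⟨U ∪ Finset.univ.biUnion fun k => (g.wires k).elim (fun _ => ∅) (fun b => {b}), ?_, ?_⟩
    · refine (Finset.card_union_le _ _).trans ?_
      rw [List.length_cons, Nat.mul_succ]
      refine Nat.add_le_add hU (Finset.card_biUnion_le.trans ?_)
      refine (Finset.sum_le_card_nsmul _ _ 1 fun k _ => ?_).trans ?_
      · rcases g.wires k with a | b <;> simp
      · simpa using hr _ g.mem
    · intro g' hg' k b hb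
      rw [List.mem_cons] at hg'
      rcases hg' with rfl | hg'
      · refine Finset.mem_union_right _ (Finset.mem_biUnion.mpr ⟨k, Finset.mem_univ _, ?_⟩)
        rw [hb]; simp
      · exact Finset.mem_union_left _ (hU' g' hg' k b hb)

/-- A circuit of size at most `S` needs at most `r * S` ancillas if its gates have arity at most
`r`. -/
lemma exists_output_eq {A B : Type} [Fintype A] [DecidableEq A] [Fintype B] [DecidableEq B] {r : ℕ}
    (hr : ∀ g ∈ G, g.arity ≤ r) {S : ℕ} (C : Circuit G (A ⊕ B)) (hC : C.size ≤ S) :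
    ∃ C' : Circuit G (A ⊕ Fin (r * S)), C'.size ≤ S ∧ C'.output = C.output := by
  obtain ⟨U, hU, hU'⟩ := exists_used_ancillas hr C
  -- All wires of `C` lie in `A` or in the used ancillas `U`, so `C` is a relabelled circuit over `A
  -- ⊕ U`.
  have h1 : C ∈ Set.range (Circuit.map (G := G)
      (Function.Embedding.sumMap (.refl A) (Function.Embedding.subtype (· ∈ U)))) := by
    refine (Set.ext_iff.mp (Set.range_list_map _) C).mpr ?_
    intro g hg
    have h2 : ∀ k, ∃ i : A ⊕ U,
        Function.Embedding.sumMap (.refl A) (Function.Embedding.subtype (· ∈ U)) i = g.wires k := by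
      intro k
      rcases h : g.wires k with a | b
      · exact ⟨Sum.inl a, rfl⟩
      · exact ⟨Sum.inr ⟨b, hU' g hg k b h⟩, rfl⟩
    choose w hw using h2
    refine ⟨⟨g.gate, g.mem, ⟨w, fun k l hkl => g.wires.injective ?_⟩⟩, ?_⟩
    · rw [← hw, ← hw, hkl]
    · cases g
      simp only [PlacedGate.map, PlacedGate.mk.injEq, heq_eq_eq, true_and]
      ext k
      exact hw k
  obtain ⟨C0, rfl⟩ := h1
  have h3 : Fintype.card U ≤ Fintype.card (Fin (r * S)) := by
    rw [Fintype.card_coe, Fintype.card_fin]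
    exact hU.trans (Nat.mul_le_mul_left r hC)
  obtain ⟨f⟩ := Function.Embedding.nonempty_of_card_le h3
  refine ⟨C0.map (Function.Embedding.sumMap (.refl A) f), ?_, ?_⟩
  · rwa [Circuit.size_map] at hC ⊢
  · rw [C0.output_map f, C0.output_map]

lemma finite_placedGate (hfin : G.Finite) [Finite ι] [Nonempty ι] {r : ℕ}
    (hr : ∀ g ∈ G, g.arity ≤ r) :
    Finite (PlacedGate G ι) ∧ Nat.card (PlacedGate G ι) ≤ G.ncard * Nat.card ι ^ r := by
  have : Finite G := hfin
  -- The wire list is padded to length `r` by an arbitrary wire; injectivity survives because the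
  -- gate, hence its arity, is recorded.
  let F : PlacedGate G ι → G × (Fin r → ι) := fun g =>
    (⟨g.gate, g.mem⟩, fun i => if h : (i : ℕ) < g.gate.arity then g.wires ⟨i, h⟩ else Classical.arbitrary ι)
  have hF : Function.Injective F := by
    rintro ⟨g, hg, w⟩ ⟨g', hg', w'⟩ h
    simp only [F, Prod.mk.injEq, Subtype.mk.injEq] at h
    obtain ⟨rfl, h⟩ := h
    congr 1
    ext k
    have := congrFun h ⟨k, k.2.trans_le (hr _ hg)⟩
    simpa using this
  refine ⟨Finite.of_injective F hF, (Nat.card_le_card_of_injective F hF).trans ?_⟩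
  rw [Nat.card_prod, Nat.card_fun, Nat.card_fin]
  rfl

/-- Encodes lists of length at most `S` as `S`-tuples with blanks; the blank symbol is the source of
the `+ 1` in the circuit count. -/
lemma exists_reduceOption_eq {α : Type} (l : List α) :
    ∀ S, l.length ≤ S → ∃ v : Fin S → Option α, (List.ofFn v).reduceOption = l := by
  induction l with
  | nil =>
    intro S _
    refine ⟨fun _ => none, ?_⟩
    rw [List.ofFn_const, List.reduceOption_replicate_none]
  | cons a l ih =>
    intro S hS
    obtain ⟨S, rfl⟩ : ∃ S', S = S' + 1 := ⟨S - 1, by simp at hS; omega⟩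
    obtain ⟨v, hv⟩ := ih S (by simpa using hS)
    refine ⟨Fin.cons (some a) v, ?_⟩
    rw [List.ofFn_cons, List.reduceOption_cons_of_some, hv]

/-- The circuits of size at most `S` have few outputs. -/
lemma exists_finset_outputs (hfin : G.Finite) {r : ℕ} (hr : ∀ g ∈ G, g.arity ≤ r)
    (N S : ℕ) (hN : 1 ≤ N) :
    ∃ T : Finset (Matrix (Fin N → Bool) (Fin N → Bool) ℂ),
      T.card ≤ (G.ncard * (N + r * S) ^ r + 1) ^ S ∧
      ∀ p (C : Circuit G (Fin N ⊕ Fin p)), C.size ≤ S → C.output ∈ T := by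
  classical
  have : Nonempty (Fin N ⊕ Fin (r * S)) := ⟨Sum.inl ⟨0, hN⟩⟩
  obtain ⟨h1, h2⟩ := finite_placedGate (ι := Fin N ⊕ Fin (r * S)) hfin hr
  have := Fintype.ofFinite (PlacedGate G (Fin N ⊕ Fin (r * S)))
  refine ⟨Finset.univ.image fun v : Fin S → Option (PlacedGate G (Fin N ⊕ Fin (r * S))) =>
    Circuit.output (G := G) (List.ofFn v).reduceOption, ?_, ?_⟩
  · refine Finset.card_image_le.trans ?_
    rw [Finset.card_univ, Fintype.card_fun, Fintype.card_fin, Fintype.card_option]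
    refine Nat.pow_le_pow_left (Nat.add_le_add_right ?_ 1) S
    simpa [Nat.card_eq_fintype_card] using h2
  · intro p C hC
    obtain ⟨C', hC', h⟩ := exists_output_eq hr C hC
    obtain ⟨v, hv⟩ := exists_reduceOption_eq C' S hC'
    rw [← h, Finset.mem_image]
    exact ⟨v, Finset.mem_univ _, congrArg (Circuit.output (G := G)) hv⟩

end relabel

/-! ## Fidelity and almost orthogonal families -/

section fidelity

/-- The fidelity `⟨v|ρ|v⟩` of a vector with the output `ρ` of a circuit. -/
def fidelity {X : Type} [Fintype X] (ρ : Matrix X X ℂ) (v : EuclideanSpace ℂ X) : ℝ :=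
  (star (v : X → ℂ) ⬝ᵥ (ρ *ᵥ (v : X → ℂ))).re

lemma fidelity_ketbra {X : Type} [Fintype X] (u v : EuclideanSpace ℂ X) :
    fidelity (ketbra (u : X → ℂ)) v = ‖inner ℂ v u‖ ^ 2 := by
  rw [fidelity, ketbra, Matrix.vecMulVec_mulVec]
  rw [dotProduct_smul, MulOpposite.smul_eq_mul_unop, MulOpposite.unop_op]
  have h1 : star (v : X → ℂ) ⬝ᵥ (u : X → ℂ) = inner ℂ v u := by
    rw [EuclideanSpace.inner_eq_star_dotProduct, dotProduct_comm]
  have h2 : star (u : X → ℂ) ⬝ᵥ (v : X → ℂ) = inner ℂ u v := by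
    rw [EuclideanSpace.inner_eq_star_dotProduct, dotProduct_comm]
  rw [h1, h2, ← inner_conj_symm u v, Complex.mul_conj']
  norm_cast

variable {G : Set Gate} {A B : Type} [Fintype A] [DecidableEq A] [Fintype B] [DecidableEq B]

/-- The (unnormalized) state of the `A`-wires given that the ancillas are in the state `b`. -/
def Circuit.branch (C : Circuit G (A ⊕ B)) (b : B → Bool) : EuclideanSpace ℂ (A → Bool) :=
  WithLp.toLp 2 fun x => C.state (Sum.elim x b)

lemma Circuit.output_eq_sum (C : Circuit G (A ⊕ B)) :
    C.output = ∑ b, ketbra (C.branch b : (A → Bool) → ℂ) := by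
  ext x y
  rw [C.output_apply, Matrix.sum_apply]
  rfl

lemma Circuit.sum_norm_branch (C : Circuit G (A ⊕ B)) : ∑ b, ‖C.branch b‖ ^ 2 = 1 := by
  rw [← C.sum_normSq_state, ← (Equiv.sumArrowEquivProdArrow A B Bool).symm.sum_comp,
    Fintype.sum_prod_type, Finset.sum_comm]
  refine Finset.sum_congr rfl fun b _ => ?_
  rw [EuclideanSpace.norm_sq_eq]
  refine Finset.sum_congr rfl fun x _ => ?_
  rw [Complex.normSq_eq_norm_sq]
  rfl

lemma isHermitian_ketbra {X : Type} (v : X → ℂ) : (ketbra v).IsHermitian := by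
  ext x y
  simp [ketbra, Matrix.vecMulVec_apply, mul_comm]

lemma Circuit.isHermitian_output (C : Circuit G (A ⊕ B)) : C.output.IsHermitian := by
  rw [C.output_eq_sum, Matrix.IsHermitian, Matrix.conjTranspose_sum]
  exact Finset.sum_congr rfl fun b _ => isHermitian_ketbra _

lemma trace_ketbra {X : Type} [Fintype X] (v : EuclideanSpace ℂ X) :
    (ketbra (v : X → ℂ)).trace = ((‖v‖ ^ 2 : ℝ) : ℂ) := by
  rw [ketbra, Matrix.trace_vecMulVec, EuclideanSpace.norm_sq_eq, dotProduct]
  push_cast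
  exact Finset.sum_congr rfl fun x _ => Complex.mul_conj' _

lemma Circuit.trace_output (C : Circuit G (A ⊕ B)) : C.output.trace = 1 := by
  rw [C.output_eq_sum, Matrix.trace_sum, Finset.sum_congr rfl fun b _ => trace_ketbra (C.branch b),
    ← Complex.ofReal_sum, C.sum_norm_branch, Complex.ofReal_one]

/-- The difference ρ - |v⟩⟨v| is Hermitian and traceless with expectation F - 1 at v. -/
lemma Circuit.one_sub_fidelity_le (C : Circuit G (A ⊕ B)) (v : EuclideanSpace ℂ (A → Bool))
    (hv : ‖v‖ = 1) : 1 - fidelity C.output v ≤ trNorm (C.output - ketbra (v : (A → Bool) → ℂ)) := by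
  have h := neg_expectation_le_trNorm (C.isHermitian_output.sub (isHermitian_ketbra v.ofLp))
    (by rw [Matrix.trace_sub, C.trace_output, trace_ketbra, hv]; simp) v hv
  refine le_trans (le_of_eq ?_) h
  rw [Matrix.sub_mulVec, dotProduct_sub, Complex.sub_re]
  have h2 := fidelity_ketbra v v
  rw [inner_self_eq_norm_sq_to_K, hv, fidelity] at h2
  rw [h2, fidelity]
  simp

/-- A Bessel inequality for almost orthogonal families. -/
lemma sum_norm_inner_sq_le {I E : Type*} [NormedAddCommGroup E] [InnerProductSpace ℂ E]
    (T : Finset I) (v : I → E) {μ : ℝ} (hμ : 0 ≤ μ) (h1 : ∀ i ∈ T, ‖v i‖ = 1)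
    (h2 : ∀ i ∈ T, ∀ j ∈ T, i ≠ j → ‖inner ℂ (v i) (v j)‖ ≤ μ) (ψ : E) :
    ∑ i ∈ T, ‖inner ℂ (v i) ψ‖ ^ 2 ≤ (1 + T.card * μ) * ‖ψ‖ ^ 2 := by
  classical
  set Q := ∑ i ∈ T, ‖inner ℂ (v i) ψ‖ ^ 2 with hQ
  have hQ0 : 0 ≤ Q := Finset.sum_nonneg fun _ _ => sq_nonneg _
  -- Here ⟨u,ψ⟩ = Q and ‖u‖² ≤ (1+|T|μ)Q, so Cauchy–Schwarz gives Q² ≤ (1+|T|μ)Q‖ψ‖².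
  set u : E := ∑ i ∈ T, (inner ℂ (v i) ψ : ℂ) • v i with hu
  have e1 : inner ℂ u ψ = (Q : ℂ) := by
    rw [hu, sum_inner, hQ]
    push_cast
    refine Finset.sum_congr rfl fun i _ => ?_
    rw [inner_smul_left, Complex.conj_mul']
  have e2 : ‖u‖ ^ 2 ≤ (1 + T.card * μ) * Q := by
    have e3 : ((‖u‖ ^ 2 : ℝ) : ℂ) = ∑ i ∈ T, ∑ j ∈ T,
        (starRingEnd ℂ) (inner ℂ (v i) ψ) * (inner ℂ (v j) ψ * inner ℂ (v i) (v j)) := by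
      have := inner_self_eq_norm_sq_to_K (𝕜 := ℂ) u
      push_cast
      rw [← Complex.coe_algebraMap] at *
      rw [← this]
      conv_lhs => rw [hu]
      rw [sum_inner]
      refine Finset.sum_congr rfl fun i _ => ?_
      rw [inner_sum]
      refine Finset.sum_congr rfl fun j _ => ?_
      rw [inner_smul_left, inner_smul_right]
    -- The μ-term is kept on the diagonal too, where it is superfluous, so that its double sum
    -- factors as a square.
    have e4 : ‖u‖ ^ 2 ≤ ∑ i ∈ T, ∑ j ∈ T,
        ((if i = j then ‖inner ℂ (v i) ψ‖ ^ 2 else 0) +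
          ‖inner ℂ (v i) ψ‖ * ‖inner ℂ (v j) ψ‖ * μ) := by
      have : ‖u‖ ^ 2 = ‖((‖u‖ ^ 2 : ℝ) : ℂ)‖ := by
        rw [Complex.norm_real, Real.norm_of_nonneg (sq_nonneg _)]
      rw [this, e3]
      refine norm_sum_le_of_le _ fun i hi => norm_sum_le_of_le _ fun j hj => ?_
      rw [norm_mul, norm_mul, RCLike.norm_conj]
      split_ifs with hij
      · subst hij
        rw [inner_self_eq_norm_sq_to_K, h1 i hi]
        norm_num
        have : 0 ≤ ‖inner ℂ (v i) ψ‖ * ‖inner ℂ (v i) ψ‖ * μ := by positivity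
        nlinarith
      · rw [zero_add, ← mul_assoc]
        exact mul_le_mul_of_nonneg_left (h2 i hi j hj hij) (by positivity)
    refine e4.trans ?_
    simp only [Finset.sum_add_distrib]
    have e5 : ∑ i ∈ T, ∑ j ∈ T, (if i = j then ‖inner ℂ (v i) ψ‖ ^ 2 else 0) = Q := by
      refine Finset.sum_congr rfl fun i hi => ?_
      rw [Finset.sum_ite_eq, if_pos hi]
    have e6 : ∑ i ∈ T, ∑ j ∈ T, ‖inner ℂ (v i) ψ‖ * ‖inner ℂ (v j) ψ‖ * μ
        = (∑ i ∈ T, ‖inner ℂ (v i) ψ‖) ^ 2 * μ := by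
      rw [sq, Finset.sum_mul_sum, Finset.sum_mul]
      exact Finset.sum_congr rfl fun i _ => by rw [Finset.sum_mul]
    rw [e5, e6]
    have e7 := sq_sum_le_card_mul_sum_sq (s := T) (f := fun i => ‖inner ℂ (v i) ψ‖)
    have e8 := mul_le_mul_of_nonneg_right e7 hμ
    rw [← hQ] at e8
    linarith
  have e9 : Q ≤ ‖u‖ * ‖ψ‖ := by
    have := norm_inner_le_norm (𝕜 := ℂ) u ψ
    rwa [e1, Complex.norm_real, Real.norm_of_nonneg hQ0] at this
  rcases hQ0.eq_or_lt with h | h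
  · rw [← h]; positivity
  · have : Q * Q ≤ (1 + T.card * μ) * ‖ψ‖ ^ 2 * Q := by
      calc Q * Q ≤ (‖u‖ * ‖ψ‖) * (‖u‖ * ‖ψ‖) := mul_self_le_mul_self hQ0 e9
        _ = ‖u‖ ^ 2 * ‖ψ‖ ^ 2 := by ring
        _ ≤ ((1 + T.card * μ) * Q) * ‖ψ‖ ^ 2 := by gcongr
        _ = _ := by ring
    exact le_of_mul_le_mul_right this h

/-- The output is the sum of the unnormalized branches; Bessel applies to each, and their squared
norms sum to 1. -/
lemma Circuit.sum_fidelity_le {I : Type*} (C : Circuit G (A ⊕ B)) (T : Finset I)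
    (v : I → EuclideanSpace ℂ (A → Bool)) {μ : ℝ} (hμ : 0 ≤ μ) (h1 : ∀ i ∈ T, ‖v i‖ = 1)
    (h2 : ∀ i ∈ T, ∀ j ∈ T, i ≠ j → ‖inner ℂ (v i) (v j)‖ ≤ μ) :
    ∑ i ∈ T, fidelity C.output (v i) ≤ 1 + T.card * μ := by
  have h : ∀ i, fidelity C.output (v i) = ∑ b, ‖inner ℂ (v i) (C.branch b)‖ ^ 2 := by
    intro i
    rw [C.output_eq_sum, fidelity, Matrix.sum_mulVec, dotProduct_sum, Complex.re_sum]
    exact Finset.sum_congr rfl fun b _ => fidelity_ketbra _ _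
  rw [Finset.sum_congr rfl fun i _ => h i, Finset.sum_comm]
  refine (Finset.sum_le_sum fun b _ => sum_norm_inner_sq_le T v hμ h1 h2 (C.branch b)).trans ?_
  rw [← Finset.mul_sum, C.sum_norm_branch, mul_one]

/-- A circuit approximates few members of an almost orthogonal family. -/
lemma Circuit.card_le_of_trNorm_le {I : Type*} (C : Circuit G (A ⊕ B)) (T : Finset I)
    (v : I → EuclideanSpace ℂ (A → Bool)) {δ : ℝ} (hδ : 0 < δ) (h1 : ∀ i ∈ T, ‖v i‖ = 1)
    (h2 : ∀ i ∈ T, ∀ j ∈ T, i ≠ j → ‖inner ℂ (v i) (v j)‖ ≤ δ / 2)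
    (h3 : ∀ i ∈ T, trNorm (C.output - ketbra (v i : (A → Bool) → ℂ)) ≤ 1 - δ) :
    (T.card : ℝ) ≤ 2 / δ := by
  have h4 := C.sum_fidelity_le T v (by positivity) h1 h2
  -- Every fidelity is at least δ, so |T|δ ≤ 1 + |T|δ/2.
  have h5 : T.card * δ ≤ ∑ i ∈ T, fidelity C.output (v i) := by
    rw [← nsmul_eq_mul]
    refine Finset.card_nsmul_le_sum _ _ _ fun i hi => ?_
    have := C.one_sub_fidelity_le (v i) (h1 i hi)
    linarith [h3 i hi]
  rw [le_div_iff₀ hδ]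
  linarith

end fidelity

/-! ## Entangled states -/

/-- The support of a completely separable state is closed under mixing of strings. -/
lemma KSeparable.amp_ne_zero {n : ℕ} {ξ : Qustring n} (h : KSeparable n ξ) {x y z : Fin n → Bool}
    (hx : ξ.amp x ≠ 0) (hy : ξ.amp y ≠ 0) (hz : ∀ i, z i = x i ∨ z i = y i) : ξ.amp z ≠ 0 := by
  obtain ⟨m, hm, φ, σ, h1, h2⟩ := h
  -- n positive lengths with sum n are all 1, so each tensor factor sees a single bit, which `z`
  -- takes from `x` or `y`.
  have h3 : ∀ j, m j = 1 := by
    have h4 : ∑ j : Fin n, 1 = ∑ j, m j := by rw [hm]; simp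
    have h5 := (Finset.sum_eq_sum_iff_of_le fun j _ => h1 j).mp h4
    exact fun j => (h5 j (Finset.mem_univ j)).symm
  rw [h2, tensorAmp, Finset.prod_ne_zero_iff] at hx hy ⊢
  intro j hj
  have h4 : ∀ u v : Fin (m j), u = v := by
    intro u v
    have := h3 j
    apply Fin.ext
    omega
  obtain ⟨i0⟩ : Nonempty (Fin (m j)) := ⟨⟨0, by rw [h3]; exact one_pos⟩⟩
  rcases hz (σ (Fin.cast hm (finSigmaFinEquiv ⟨j, i0⟩))) with h5 | h5
  · convert hx j hj using 3 with i
    rw [h4 i i0]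
    exact h5
  · convert hy j hj using 3 with i
    rw [h4 i i0]
    exact h5

lemma partiallyEntangled_of_not_kSeparable {n : ℕ} (hn : 1 ≤ n) {ξ : Qustring n}
    (h : ¬ KSeparable n ξ) : PartiallyEntangled ξ := by
  classical
  rw [PartiallyEntangled, Nat.succ_le_iff]
  refine lt_of_le_of_ne (Nat.findGreatest_le n) fun h1 => h ?_
  have := Nat.findGreatest_of_ne_zero (P := fun k => KSeparable k ξ) h1 (by omega)
  exact this

/-- The vector `2 ^ (-m / 2) ∑ₐ |a⟩|f a⟩`. -/
def graphVec {m r : ℕ} (f : (Fin m → Bool) → (Fin r → Bool)) :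
    EuclideanSpace ℂ (Fin (m + r) → Bool) :=
  WithLp.toLp 2 fun x =>
    if f (x ∘ Fin.castAdd r) = x ∘ Fin.natAdd m then (((Real.sqrt (2 ^ m))⁻¹ : ℝ) : ℂ) else 0

lemma graphVec_append {m r : ℕ} (f : (Fin m → Bool) → (Fin r → Bool)) (a : Fin m → Bool)
    (b : Fin r → Bool) : graphVec f (Fin.append a b) =
      if f a = b then (((Real.sqrt (2 ^ m))⁻¹ : ℝ) : ℂ) else 0 := by
  have h1 : Fin.append a b ∘ Fin.castAdd r = a := by funext i; simp
  have h2 : Fin.append a b ∘ Fin.natAdd m = b := by funext i; simp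
  rw [graphVec]
  simp only [h1, h2]

/-- Only points common to both graphs contribute, each 2^(-m). -/
lemma inner_graphVec {m r : ℕ} (f g : (Fin m → Bool) → (Fin r → Bool)) :
    inner ℂ (graphVec f) (graphVec g)
      = (((Finset.univ.filter fun a => f a = g a).card / 2 ^ m : ℝ) : ℂ) := by
  rw [PiLp.inner_apply, ← (Fin.appendEquiv m r).sum_comp, Fintype.sum_prod_type]
  have h : (((Real.sqrt (2 ^ m))⁻¹ : ℝ) : ℂ) * (((Real.sqrt (2 ^ m))⁻¹ : ℝ) : ℂ)
      = ((1 / 2 ^ m : ℝ) : ℂ) := by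
    rw [← Complex.ofReal_mul, ← mul_inv, Real.mul_self_sqrt (by positivity), one_div]
  have h2 : ∀ a b, inner ℂ (graphVec f (Fin.appendEquiv m r (a, b)))
      (graphVec g (Fin.appendEquiv m r (a, b))) =
      if f a = b then (if f a = g a then ((1 / 2 ^ m : ℝ) : ℂ) else 0) else 0 := by
    intro a b
    change inner ℂ (graphVec f (Fin.append a b)) (graphVec g (Fin.append a b)) = _
    rw [graphVec_append, graphVec_append]
    by_cases h1 : f a = b
    · subst h1
      by_cases h2 : f a = g a
      · simp only [h2, if_true]
        rw [← h, RCLike.inner_apply, Complex.conj_ofReal]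
      · simp [h2, Ne.symm h2]
    · simp [h1]
  simp only [h2, Finset.sum_ite_eq, Finset.mem_univ, if_true]
  rw [← Finset.sum_filter, Finset.sum_const, nsmul_eq_mul]
  push_cast
  ring

lemma norm_graphVec {m r : ℕ} (f : (Fin m → Bool) → (Fin r → Bool)) : ‖graphVec f‖ = 1 := by
  have h : ((‖graphVec f‖ : ℂ)) ^ 2 = 1 := by
    have h0 := inner_self_eq_norm_sq_to_K (𝕜 := ℂ) (graphVec f)
    refine h0.symm.trans ?_
    rw [inner_graphVec]
    simp
  have h2 : ‖graphVec f‖ ^ 2 = 1 := by exact_mod_cast h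
  rw [← Real.sqrt_sq (norm_nonneg (graphVec f)), h2, Real.sqrt_one]

/-- (a, f a) and (b, f b) lie in the support, but their mixture (b, f a) does not. -/
lemma partiallyEntangled_graphVec {m r : ℕ} {f : (Fin m → Bool) → (Fin r → Bool)}
    {a b : Fin m → Bool} (hab : f a ≠ f b) :
    PartiallyEntangled (⟨graphVec f, norm_graphVec f⟩ : Qustring (m + r)) := by
  have hpos : (((Real.sqrt (2 ^ m))⁻¹ : ℝ) : ℂ) ≠ 0 := by
    rw [Complex.ofReal_ne_zero]; positivity
  apply partiallyEntangled_of_not_kSeparable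
  · have : ¬ m = 0 := by
      rintro rfl
      exact hab (congrArg f (Subsingleton.elim _ _))
    omega
  · intro h
    refine h.amp_ne_zero (x := Fin.append a (f a)) (y := Fin.append b (f b))
      (z := Fin.append b (f a)) ?_ ?_ ?_ ?_
    · exact ne_of_eq_of_ne ((graphVec_append _ _ _).trans (if_pos rfl)) hpos
    · exact ne_of_eq_of_ne ((graphVec_append _ _ _).trans (if_pos rfl)) hpos
    · intro i
      refine Fin.addCases (fun i => ?_) (fun i => ?_) i
      · right; simp
      · left; simp
    · exact (graphVec_append _ _ _).trans (if_neg hab.symm)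

/-- Reed–Solomon codes give large almost orthogonal families of entangled states. -/
lemma exists_entangled_family {m r d : ℕ} (hm : 1 ≤ m) (hmr : m ≤ r) (hd0 : 0 < d) (hd : d < 2 ^ m) :
    ∃ (I : Type) (_ : Fintype I) (v : I → Qustring (m + r)), Fintype.card I = (2 ^ m) ^ d ∧
      (∀ i, PartiallyEntangled (v i)) ∧
      ∀ i j, i ≠ j → ‖inner ℂ (v i).1 (v j).1‖ ≤ (d / 2 ^ m : ℝ) := by
  classical
  have : Fact (Nat.Prime 2) := ⟨Nat.prime_two⟩
  let F := GaloisField 2 m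
  have : Fintype F := Fintype.ofFinite F
  have hF : Fintype.card F = 2 ^ m := by
    rw [← Nat.card_eq_fintype_card]
    exact GaloisField.card 2 m (by omega)
  obtain ⟨e⟩ : Nonempty ((Fin m → Bool) ≃ F) := by
    rw [← Fintype.card_eq, hF]; simp
  obtain ⟨t⟩ : Nonempty (F ↪ (Fin r → Bool)) := by
    apply Function.Embedding.nonempty_of_card_le
    rw [hF]
    simpa using Nat.pow_le_pow_right two_pos hmr
  let P : (Fin d → F) → Polynomial F := fun c => ((Polynomial.degreeLTEquiv F d).symm c : Polynomial F)
  have hP : ∀ c, (P c).degree < d := fun c =>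
    Polynomial.mem_degreeLT.mp ((Polynomial.degreeLTEquiv F d).symm c).2
  -- The leading X^d makes every polynomial nonconstant, hence its state entangled, and cancels in
  -- differences.
  let f : (Fin d → F) → (Fin m → Bool) → (Fin r → Bool) := fun c a =>
    t ((Polynomial.X ^ d + P c).eval (e a))
  refine ⟨Fin d → F, inferInstance, fun c => ⟨graphVec (f c), norm_graphVec _⟩, ?_, ?_, ?_⟩
  · rw [Fintype.card_fun, hF, Fintype.card_fin]
  · intro c
    by_contra hc
    have h1 : ∀ x y : F, (Polynomial.X ^ d + P c).eval x = (Polynomial.X ^ d + P c).eval y := by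
      intro x y
      by_contra hxy
      refine hc (partiallyEntangled_graphVec (a := e.symm x) (b := e.symm y) fun h => hxy ?_)
      simpa [f] using h
    set k := (Polynomial.X ^ d + P c).eval 0
    have h2 : (Polynomial.X ^ d + P c - Polynomial.C k).natDegree = d := by
      rw [Polynomial.natDegree_sub_C, Polynomial.natDegree_add_eq_left_of_degree_lt,
        Polynomial.natDegree_X_pow]
      rw [Polynomial.degree_X_pow]
      exact hP c
    have h3 : Polynomial.X ^ d + P c - Polynomial.C k ≠ 0 := by
      intro h; rw [h] at h2; simp at h2; omega
    -- A constant value would give a polynomial of degree d < 2^m vanishing on the whole field.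
    have h4 := Polynomial.card_le_degree_of_subset_roots (p := Polynomial.X ^ d + P c - Polynomial.C k)
      (Z := Finset.univ) (by
        intro x _
        rw [Polynomial.mem_roots h3, Polynomial.IsRoot, Polynomial.eval_sub, Polynomial.eval_C,
          sub_eq_zero]
        exact h1 x 0)
    rw [h2, Finset.card_univ, hF] at h4
    omega
  · intro c c' hcc
    change ‖inner ℂ (graphVec (f c)) (graphVec (f c'))‖ ≤ _
    rw [inner_graphVec, Complex.norm_real, Real.norm_of_nonneg (by positivity)]
    refine div_le_div_of_nonneg_right ?_ (by positivity)
    have h3 : P c - P c' ≠ 0 := by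
      intro h
      apply hcc
      apply (Polynomial.degreeLTEquiv F d).symm.injective
      exact Subtype.ext (sub_eq_zero.mp h)
    have h5 : (P c - P c').natDegree < d := by
      rw [Polynomial.natDegree_lt_iff_degree_lt h3]
      exact (Polynomial.degree_sub_le _ _).trans_lt (max_lt (hP c) (hP c'))
    have h4 := Polynomial.card_le_degree_of_subset_roots (p := P c - P c')
      (Z := (Finset.univ.filter fun a => f c a = f c' a).map e.toEmbedding) (by
        intro x hx
        rw [Polynomial.mem_roots h3, Polynomial.IsRoot, Polynomial.eval_sub, sub_eq_zero]
        obtain ⟨a, ha, rfl⟩ := Finset.mem_map.mp hx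
        simpa [f] using ha)
    rw [Finset.card_map] at h4
    exact_mod_cast h4.trans h5.le

/-! ## Entangled states that are hard to approximate -/

/-- The graph of the map copying one bit to all others is a GHZ state. It serves as filler at the
lengths where no hard state is available. -/
lemma exists_partiallyEntangled {N : ℕ} (hN : 2 ≤ N) : ∃ ξ : Qustring N, PartiallyEntangled ξ := by
  obtain ⟨r, rfl⟩ : ∃ r, N = 1 + r := ⟨N - 1, by omega⟩
  exact ⟨_, partiallyEntangled_graphVec (f := fun a _ => a 0) (a := fun _ => true)
    (b := fun _ => false) fun h => by simpa using congrFun h ⟨0, by omega⟩⟩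

/-- Pigeonhole: if every partially entangled state had a good circuit, the family would map to the
outputs with fibres of size at most `k`, contradicting `hcard`. -/
lemma exists_not_approximated {G : Set Gate} (hfin : G.Finite) {r : ℕ}
    (hr : ∀ g ∈ G, g.arity ≤ r) {δ : ℝ} (hδ : 0 < δ) {N S d k : ℕ} (hN : 2 ≤ N)
    (hd0 : 0 < d) (hd : d < 2 ^ (N / 2)) (hdδ : (d / 2 ^ (N / 2) : ℝ) ≤ δ / 2) (hk : 2 / δ < k + 1)
    (hcard : k * (G.ncard * (N + r * S) ^ r + 1) ^ S < (2 ^ (N / 2)) ^ d) :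
    ∃ ξ : Qustring N, PartiallyEntangled ξ ∧ ∀ p (C : Circuit G (Fin N ⊕ Fin p)), C.size ≤ S →
      1 - δ < trNorm (C.output - ketbra ξ.amp) := by
  classical
  obtain ⟨T, hT, hT'⟩ := exists_finset_outputs hfin hr N S (by omega)
  by_contra! hcon
  obtain ⟨I, _, v, hI, hv, hvv⟩ : ∃ (I : Type) (_ : Fintype I) (v : I → Qustring N),
      Fintype.card I = (2 ^ (N / 2)) ^ d ∧ (∀ i, PartiallyEntangled (v i)) ∧
      ∀ i j, i ≠ j → ‖inner ℂ (v i).1 (v j).1‖ ≤ (d / 2 ^ (N / 2) : ℝ) := by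
    have h := exists_entangled_family (m := N / 2) (r := N - N / 2) (d := d) (by omega) (by omega)
      hd0 hd
    rwa [show N / 2 + (N - N / 2) = N by omega] at h
  choose p C hC hCv using fun i => hcon (v i) (hv i)
  have h1 := Finset.card_le_mul_card_image (f := fun i => (C i).output) Finset.univ k (by
    intro ρ hρ
    obtain ⟨i0, -, rfl⟩ := Finset.mem_image.mp hρ
    have h2 := (C i0).card_le_of_trNorm_le (Finset.univ.filter fun i => (C i).output = (C i0).output)
      (fun i => (v i).1) hδ (fun i _ => (v i).2) (fun i _ j _ hij => (hvv i j hij).trans hdδ) (by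
        intro i hi
        rw [← (Finset.mem_filter.mp hi).2]
        exact hCv i)
    rw [← Nat.lt_succ_iff]
    exact_mod_cast h2.trans_lt hk)
  have h3 : (Finset.univ.image fun i => (C i).output).card ≤ T.card := by
    refine Finset.card_le_card fun ρ hρ => ?_
    obtain ⟨i, -, rfl⟩ := Finset.mem_image.mp hρ
    exact hT' _ _ (hC i)
  rw [Finset.card_univ, hI] at h1
  exact absurd (h1.trans (Nat.mul_le_mul_left k (h3.trans hT))) (not_le.mpr hcard)

/-- For S ≤ 2^N the number of choices for each gate is 2^O(N), so the exponent of the total is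
linear in S; this is what the degree d has to beat. -/
lemma count_bound {g r k N S : ℕ} (hN : 1 ≤ N) (hS1 : 1 ≤ S) (hS : S ≤ 2 ^ N) :
    k * (g * (N + r * S) ^ r + 1) ^ S ≤ 2 ^ ((r * (r + 1) + g + 1 + k) * N * S) := by
  have h1 : N + r * S ≤ 2 ^ ((r + 1) * N) := by
    calc N + r * S ≤ 2 ^ N + r * 2 ^ N :=
          Nat.add_le_add Nat.lt_two_pow_self.le (Nat.mul_le_mul_left r hS)
      _ = (r + 1) * 2 ^ N := by ring
      _ ≤ 2 ^ r * 2 ^ N := Nat.mul_le_mul_right _ Nat.lt_two_pow_self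
      _ = 2 ^ (r + N) := (pow_add _ _ _).symm
      _ ≤ 2 ^ ((r + 1) * N) := Nat.pow_le_pow_right two_pos (by nlinarith)
  have h2 : g * (N + r * S) ^ r + 1 ≤ 2 ^ ((r * (r + 1) + g + 1) * N) := by
    calc g * (N + r * S) ^ r + 1 ≤ 2 ^ g * (2 ^ ((r + 1) * N)) ^ r + 1 :=
          Nat.add_le_add_right (Nat.mul_le_mul Nat.lt_two_pow_self.le (Nat.pow_le_pow_left h1 r)) 1
      _ ≤ 2 ^ g * (2 ^ ((r + 1) * N)) ^ r + 2 ^ g * (2 ^ ((r + 1) * N)) ^ r :=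
          Nat.add_le_add_left (Nat.one_le_iff_ne_zero.mpr (by positivity)) _
      _ = 2 ^ (g + (r + 1) * N * r + 1) := by rw [← pow_mul, ← pow_add, pow_succ]; ring
      _ ≤ _ := Nat.pow_le_pow_right two_pos (by nlinarith)
  calc k * (g * (N + r * S) ^ r + 1) ^ S
      ≤ 2 ^ k * (2 ^ ((r * (r + 1) + g + 1) * N)) ^ S :=
        Nat.mul_le_mul Nat.lt_two_pow_self.le (Nat.pow_le_pow_left h2 S)
    _ = 2 ^ (k + (r * (r + 1) + g + 1) * N * S) := by rw [← pow_mul, ← pow_add]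
    _ ≤ _ := by
      refine Nat.pow_le_pow_right two_pos ?_
      have : k * 1 ≤ k * (N * S) := Nat.mul_le_mul_left k (Nat.mul_pos hN hS1)
      nlinarith

lemma eventually_exists_not_approximated {G : Set Gate} (hfin : G.Finite) {δ : ℝ} (hδ : 0 < δ)
    (hδ1 : δ < 1) : ∀ᶠ N : ℕ in atTop, ∃ ξ : Qustring N, PartiallyEntangled ξ ∧
      ∀ p (C : Circuit G (Fin N ⊕ Fin p)), C.size ≤ 2 ^ (N / 8) →
        1 - δ < trNorm (C.output - ketbra ξ.amp) := by
  obtain ⟨r, hr⟩ : ∃ r, ∀ g ∈ G, g.arity ≤ r := by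
    obtain ⟨r, hr⟩ := (hfin.image Gate.arity).bddAbove
    exact ⟨r, fun g hg => hr ⟨g, hg, rfl⟩⟩
  set k := ⌊2 / δ⌋₊
  set A := r * (r + 1) + G.ncard + 1 + k
  have hlim : Tendsto (fun N : ℕ => (2 : ℝ) ^ (N / 8)) atTop atTop :=
    (tendsto_pow_atTop_atTop_of_one_lt one_lt_two).comp (Nat.tendsto_div_const_atTop (by norm_num))
  filter_upwards [hlim.eventually_ge_atTop ((3 * A + 2) * (2 / δ)), eventually_ge_atTop 8]
    with N hN hN8
  set S := 2 ^ (N / 8) with hS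
  -- S² ≤ 2^(N/2), and one factor S absorbs the constants. The 3 comes from N ≤ 3⌊N/2⌋, the 2 from
  -- rounding d down.
  have hbig : (3 * A + 2) * (S : ℝ) ≤ δ / 2 * 2 ^ (N / 2) := by
    have h1 : (2 : ℝ) ^ (N / 8) * 2 ^ (N / 8) ≤ 2 ^ (N / 2) := by
      rw [← pow_add]; exact pow_le_pow_right₀ one_le_two (by omega)
    have h2 : (3 * A + 2 : ℝ) ≤ δ / 2 * 2 ^ (N / 8) := by
      rw [← mul_div_assoc, div_le_iff₀ hδ] at hN
      linarith
    have h3 : (S : ℝ) = 2 ^ (N / 8) := by rw [hS]; push_cast; rfl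
    have h4 : (0 : ℝ) < 2 ^ (N / 8) := by positivity
    rw [h3]
    nlinarith
  have hS1 : 1 ≤ S := Nat.one_le_two_pow
  have hd1 : (⌊δ / 2 * 2 ^ (N / 2)⌋₊ : ℝ) ≤ δ / 2 * 2 ^ (N / 2) := Nat.floor_le (by positivity)
  have hd2 : 3 * A * S < ⌊δ / 2 * 2 ^ (N / 2)⌋₊ := by
    rw [← Nat.succ_le_iff]
    apply Nat.le_floor
    push_cast
    have : (1 : ℝ) ≤ S := by exact_mod_cast hS1
    linarith
  -- d is the largest degree for which the overlaps stay below δ/2.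
  refine exists_not_approximated hfin hr hδ (d := ⌊δ / 2 * 2 ^ (N / 2)⌋₊) (k := k) (by omega)
    (Nat.zero_lt_of_lt hd2) ?_ ?_
    (Nat.lt_floor_add_one _) ?_
  · have h2 : (0 : ℝ) < 2 ^ (N / 2) := by positivity
    have : (⌊δ / 2 * 2 ^ (N / 2)⌋₊ : ℝ) < 2 ^ (N / 2) := by nlinarith
    exact_mod_cast this
  · rwa [div_le_iff₀ (by positivity)]
  · refine (count_bound (by omega) hS1 (Nat.pow_le_pow_right two_pos (by omega))).trans_lt ?_
    rw [← pow_mul]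
    refine Nat.pow_lt_pow_right one_lt_two ?_
    have h3 : N ≤ 3 * (N / 2) := by omega
    calc A * N * S ≤ A * (3 * (N / 2)) * S := by gcongr
      _ = N / 2 * (3 * A * S) := by ring
      _ < _ := Nat.mul_lt_mul_of_pos_left hd2 (by omega)

lemma eventually_poly_le_two_pow (C : ℝ) (c : ℕ) :
    ∀ᶠ N : ℕ in atTop, C * (N : ℝ) ^ c ≤ 2 ^ (N / 8) := by
  have h1 := tendsto_pow_const_div_const_pow_of_one_lt c (one_lt_two : (1 : ℝ) < 2)
  have h2 : Tendsto (fun N : ℕ => N / 8 + 1) atTop atTop :=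
    (tendsto_add_atTop_nat 1).comp (Nat.tendsto_div_const_atTop (by norm_num))
  have h3 := (h1.comp h2).eventually (gt_mem_nhds (show (0 : ℝ) < (2 * (|C| + 1) * 8 ^ c)⁻¹ by positivity))
  filter_upwards [h3] with N hN
  simp only [Function.comp] at hN
  rw [div_lt_iff₀ (by positivity), inv_mul_eq_div, lt_div_iff₀ (by positivity), pow_succ] at hN
  have h4 : (N : ℝ) ≤ 8 * ((N / 8 + 1 : ℕ) : ℝ) := by
    have : N ≤ 8 * (N / 8 + 1) := by omega
    exact_mod_cast this
  have h5 : (N : ℝ) ^ c ≤ 8 ^ c * ((N / 8 + 1 : ℕ) : ℝ) ^ c := by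
    rw [← mul_pow]; exact pow_le_pow_left₀ (by positivity) h4 c
  have h6 : C * (N : ℝ) ^ c ≤ (|C| + 1) * (8 ^ c * ((N / 8 + 1 : ℕ) : ℝ) ^ c) :=
    mul_le_mul (by linarith [le_abs_self C]) h5 (by positivity) (by positivity)
  linarith

/-- The ensemble must not depend on `s`. Each state is chosen against all circuits of size
2^(ℓ(n)/8) whenever this is possible; that bound eventually exceeds every polynomial in n because n
≤ ℓ(n). -/
theorem exists_not_approximable {G : Set Gate} (hfin : G.Finite) {ε : ℝ} (h0 : 0 < ε) (h1 : ε < 1)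
    {ℓ : ℕ → ℕ} (hℓ : StrictMono ℓ) (hℓ2 : 2 ≤ ℓ 0) :
    ∃ ξ : (n : ℕ) → Qustring (ℓ n), IsEntanglementEnsemble ℓ ξ ∧
      ∀ s : ℕ → ℕ, (∃ c : ℕ, (fun n => (s n : ℝ)) =O[atTop] fun n => (n : ℝ) ^ c) →
        ¬ Approximable G ℓ ξ (fun _ => ε) (fun n => (s n : ℝ)) := by
  have hex : ∀ n, ∃ ξ : Qustring (ℓ n), PartiallyEntangled ξ ∧
      ((∃ ξ : Qustring (ℓ n), PartiallyEntangled ξ ∧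
        ∀ p (C : Circuit G (Fin (ℓ n) ⊕ Fin p)), C.size ≤ 2 ^ (ℓ n / 8) →
          ε < trNorm (C.output - ketbra ξ.amp)) →
        ∀ p (C : Circuit G (Fin (ℓ n) ⊕ Fin p)), C.size ≤ 2 ^ (ℓ n / 8) →
          ε < trNorm (C.output - ketbra ξ.amp)) := by
    intro n
    by_cases h : ∃ ξ : Qustring (ℓ n), PartiallyEntangled ξ ∧
        ∀ p (C : Circuit G (Fin (ℓ n) ⊕ Fin p)), C.size ≤ 2 ^ (ℓ n / 8) →
          ε < trNorm (C.output - ketbra ξ.amp)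
    · obtain ⟨ξ, h2, h3⟩ := h
      exact ⟨ξ, h2, fun _ => h3⟩
    · obtain ⟨ξ, hξ⟩ := exists_partiallyEntangled (hℓ2.trans (hℓ.monotone (Nat.zero_le n)))
      exact ⟨ξ, hξ, fun h' => absurd h' h⟩
  choose ξ hξ hhard using hex
  refine ⟨ξ, ⟨hℓ, hξ⟩, ?_⟩
  rintro s ⟨c, hs⟩ ⟨p, C, hsize, happ⟩
  obtain ⟨K, hK⟩ := hs.bound
  have e1 := hℓ.tendsto_atTop.eventually
    (eventually_exists_not_approximated hfin (sub_pos.mpr h1) (by linarith : 1 - ε < 1))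
  have e2 := hℓ.tendsto_atTop.eventually (eventually_poly_le_two_pow (|K|) c)
  obtain ⟨n, h2, h3, h4, h5⟩ := (e1.and (e2.and (hK.and happ))).exists
  rw [sub_sub_cancel] at h2
  refine absurd h5 (not_le.mpr (hhard n h2 _ (C n) ?_))
  have h6 : ((C n).size : ℝ) ≤ 2 ^ (ℓ n / 8) := by
    refine (hsize n).trans (le_trans ?_ h3)
    rw [Real.norm_of_nonneg (by positivity), Real.norm_of_nonneg (by positivity)] at h4
    refine h4.trans ?_
    have h7 : (n : ℝ) ≤ ℓ n := by exact_mod_cast hℓ.id_le n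
    exact mul_le_mul (le_abs_self K) (pow_le_pow_left₀ (by positivity) h7 c) (by positivity)
      (abs_nonneg K)
  exact_mod_cast h6

/-! ## Operators implemented by circuits -/

section impl

variable {G : Set Gate} {ι : Type} [Fintype ι] [DecidableEq ι]

/-- The operator `F` is computed by a circuit of size at most `s`. -/
def Impl (G : Set Gate) (s : ℕ) (F : ((ι → Bool) → ℂ) → (ι → Bool) → ℂ) : Prop :=
  ∃ C : Circuit G ι, C.size ≤ s ∧ ∀ ψ, C.toMatrix *ᵥ ψ = F ψ

lemma impl_id : Impl G 0 (fun ψ : (ι → Bool) → ℂ => ψ) :=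
  ⟨([] : List _), le_rfl, fun ψ => Matrix.one_mulVec ψ⟩

/-- The circuit `C` followed by the circuit `D`. -/
def Circuit.seq (C D : Circuit G ι) : Circuit G ι := List.append C D

lemma Circuit.toMatrix_seq (C D : Circuit G ι) :
    (C.seq D).toMatrix = D.toMatrix * C.toMatrix :=
  Circuit.toMatrix_append C D

lemma Impl.comp {s t : ℕ} {F F' : ((ι → Bool) → ℂ) → (ι → Bool) → ℂ} (h' : Impl G t F')
    (h : Impl G s F) : Impl G (s + t) (fun ψ => F' (F ψ)) := by
  obtain ⟨C, hC, hF⟩ := h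
  obtain ⟨D, hD, hF'⟩ := h'
  refine ⟨C.seq D, ?_, fun ψ => ?_⟩
  · exact (List.length_append (as := C) (bs := D)).trans_le (Nat.add_le_add hC hD)
  · rw [Circuit.toMatrix_seq, ← Matrix.mulVec_mulVec, hF, hF']

lemma impl_gate {k : ℕ} {M : Matrix (Fin k → Bool) (Fin k → Bool) ℂ}
    {hM : M ∈ Matrix.unitaryGroup (Fin k → Bool) ℂ} (hg : (⟨k, M, hM⟩ : Gate) ∈ G)
    (w : Fin k ↪ ι) : Impl G 1 (fun ψ x => ∑ u, M (x ∘ w) u * ψ (Function.extend w u x)) := by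
  refine ⟨([⟨_, hg, w⟩] : List (PlacedGate G ι)), le_rfl, fun ψ => ?_⟩
  have h : Circuit.toMatrix (G := G) ([⟨_, hg, w⟩] : List (PlacedGate G ι)) = lift w M := by
    rw [Circuit.toMatrix_cons, Circuit.toMatrix_nil, Matrix.one_mul]
    rfl
  refine (congrArg (· *ᵥ ψ) h).trans ?_
  funext x
  exact lift_mulVec w _ ψ x

end impl

/-! ### Bit-string maps induced by gates on one or two wires -/

section wires

variable {ι : Type} [DecidableEq ι]

/-- The embedding of a single wire. -/
def wire (i : ι) : Fin 1 ↪ ι := ⟨fun _ => i, fun _ _ _ => Subsingleton.elim _ _⟩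

lemma extend_wire (i : ι) (u : Fin 1 → Bool) (x : ι → Bool) :
    Function.extend (wire i) u x = Function.update x i (u 0) := by
  funext j
  by_cases hj : j = i
  · subst hj
    rw [Function.update_self]
    exact (wire j).injective.extend_apply u x 0
  · rw [Function.update_of_ne hj, Function.extend_apply']
    rintro ⟨k, hk⟩
    exact hj hk.symm

/-- The embedding of two distinct wires. -/
def wires₂ {i j : ι} (h : i ≠ j) : Fin 2 ↪ ι :=
  ⟨![i, j], by
    intro a b hab
    fin_cases a <;> fin_cases b <;> simp_all [eq_comm]⟩

lemma extend_wires₂ {i j : ι} (h : i ≠ j) (u : Fin 2 → Bool) (x : ι → Bool) :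
    Function.extend (wires₂ h) u x = Function.update (Function.update x i (u 0)) j (u 1) := by
  funext k
  by_cases hj : k = j
  · subst hj
    rw [Function.update_self]
    exact (wires₂ h).injective.extend_apply u x 1
  · rw [Function.update_of_ne hj]
    by_cases hi : k = i
    · subst hi
      rw [Function.update_self]
      exact (wires₂ h).injective.extend_apply u x 0
    · rw [Function.update_of_ne hi, Function.extend_apply']
      rintro ⟨l, hl⟩
      fin_cases l
      · exact hi hl.symm
      · exact hj hl.symm

/-- The string `x` with bit `i` flipped. -/
def flipBit (i : ι) (x : ι → Bool) : ι → Bool := Function.update x i (!x i)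

/-- The action of a Controlled-NOT from `i` to `j` on strings. -/
def cnotBit (i j : ι) (x : ι → Bool) : ι → Bool := Function.update x j (xor (x i) (x j))

lemma flipBit_flipBit (i : ι) (x : ι → Bool) : flipBit i (flipBit i x) = x := by
  simp [flipBit]

lemma cnotBit_cnotBit {i j : ι} (h : i ≠ j) (x : ι → Bool) : cnotBit i j (cnotBit i j x) = x := by
  simp [cnotBit, Function.update_of_ne h]

end wires

/-! ### The standard gates acting on amplitudes, and diagonal phases -/

section gates

variable {G : Set Gate} {ι : Type} [Fintype ι] [DecidableEq ι]

lemma impl_not (hG : standardGates ⊆ G) (i : ι) :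
    Impl G 1 (fun (ψ : (ι → Bool) → ℂ) x => ψ (flipBit i x)) := by
  have h := impl_gate (hM := notMat_mem) (hG (show notGate ∈ standardGates by simp [standardGates])) (wire i)
  convert h using 3 with ψ x
  refine Eq.symm ((sum_fin_one _).trans ?_)
  have e : ∀ b : Bool, notMat (x ∘ wire i) (fun _ => b)
      = if x i = !b then 1 else 0 := fun b => rfl
  rw [e, e, extend_wire, extend_wire, flipBit]
  cases x i <;> simp

lemma impl_hadamard (hG : standardGates ⊆ G) (i : ι) :
    Impl G 1 (fun (ψ : (ι → Bool) → ℂ) x => (ψ (Function.update x i false) +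
      (if x i then -1 else 1) * ψ (Function.update x i true)) / (Real.sqrt 2 : ℂ)) := by
  have h := impl_gate (hM := hadamardMat_mem) (hG (show hadamardGate ∈ standardGates by simp [standardGates])) (wire i)
  convert h using 3 with ψ x
  refine Eq.symm ((sum_fin_one _).trans ?_)
  have e : ∀ b : Bool, hadamardMat (x ∘ wire i) (fun _ => b)
      = (if x i && b then -1 else 1) / (Real.sqrt 2 : ℂ) := fun b => rfl
  rw [e, e, extend_wire, extend_wire]
  cases x i <;> simp <;> ring

/-- The primitive eighth root of unity `e^{iπ/4}`. -/
def omega8 : ℂ := Complex.exp (Complex.I * (Real.pi / 4))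

lemma omega8_sq : omega8 ^ 2 = Complex.I := by
  rw [omega8, ← Complex.exp_nat_mul]
  refine Eq.trans ?_ Complex.exp_pi_div_two_mul_I
  refine congrArg Complex.exp ?_
  push_cast
  ring

lemma omega8_pow_four : omega8 ^ 4 = -1 := by
  rw [show 4 = 2 * 2 from rfl, pow_mul, omega8_sq, Complex.I_sq]

lemma impl_T (hG : standardGates ⊆ G) (i : ι) :
    Impl G 1 (fun (ψ : (ι → Bool) → ℂ) x => (if x i then omega8 else 1) * ψ x) := by
  have h := impl_gate (hM := tMat_mem) (hG (show tGate ∈ standardGates by simp [standardGates])) (wire i)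
  convert h using 3 with ψ x
  refine Eq.symm ((sum_fin_one _).trans ?_)
  have e : ∀ b : Bool, tMat (x ∘ wire i) (fun _ => b)
      = if x i = b then (if x i then omega8 else 1) else 0 := by
    intro b
    rw [tMat, Matrix.diagonal_apply, omega8]
    refine if_congr ?_ rfl rfl
    rw [funext_iff, Fin.forall_fin_one]
    rfl
  rw [e, e, extend_wire, extend_wire]
  cases hx : x i <;> simp <;> simp [← hx]

lemma impl_cnot (hG : standardGates ⊆ G) {i j : ι} (hij : i ≠ j) :
    Impl G 1 (fun (ψ : (ι → Bool) → ℂ) x => ψ (cnotBit i j x)) := by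
  have h := impl_gate (hM := cnotMat_mem) (hG (show cnotGate ∈ standardGates by simp [standardGates])) (wires₂ hij)
  convert h using 3 with ψ x
  have e : ∀ u : Fin 2 → Bool, cnotMat (x ∘ wires₂ hij) u
      = if x i = u 0 ∧ x j = xor (u 0) (u 1) then 1 else 0 := fun u => rfl
  refine Eq.symm ((Finset.sum_eq_single (![x i, xor (x i) (x j)] : Fin 2 → Bool) ?_ ?_).trans ?_)
  · intro u _ hu
    rw [e, if_neg, zero_mul]
    rintro ⟨h1, h2⟩
    apply hu
    funext k
    fin_cases k
    · exact h1.symm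
    · change u 1 = xor (x i) (x j)
      rw [h2, h1]; simp
  · intro h; exact absurd (Finset.mem_univ _) h
  · rw [e, extend_wires₂, if_pos ⟨rfl, by simp⟩, one_mul, cnotBit]
    congr 1
    change Function.update (Function.update x i (x i)) j (xor (x i) (x j)) = _
    rw [Function.update_eq_self]

/-! ## Diagonal operators -/

/-- The circuit size of a diagonal operator. -/
def ImplDiag (G : Set Gate) (s : ℕ) (d : (ι → Bool) → ℂ) : Prop :=
  Impl G s (fun ψ x => d x * ψ x)

lemma ImplDiag.mul {s t : ℕ} {d e : (ι → Bool) → ℂ} (hd : ImplDiag G s d) (he : ImplDiag G t e) :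
    ImplDiag G (s + t) (fun x => e x * d x) := by
  have := Impl.comp he hd
  simpa only [ImplDiag, mul_assoc] using this

lemma ImplDiag.conj {s t : ℕ} {d : (ι → Bool) → ℂ} {π : (ι → Bool) → (ι → Bool)}
    (hd : ImplDiag G s d) (hπ : Impl G t (fun (ψ : (ι → Bool) → ℂ) x => ψ (π x)))
    (hinv : ∀ x, π (π x) = x) : ImplDiag G (t + s + t) (fun x => d (π x)) := by
  have := hπ.comp (Impl.comp hd hπ)
  simpa only [ImplDiag, hinv] using this

lemma implDiag_T_pow (hG : standardGates ⊆ G) (i : ι) (k : ℕ) :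
    ImplDiag G k (fun x : ι → Bool => if x i then omega8 ^ k else 1) := by
  induction k with
  | zero => simpa [ImplDiag] using (impl_id (G := G) (ι := ι))
  | succ k ih =>
    have h := ImplDiag.mul ih (impl_T hG i)
    convert h using 2 with x
    cases x i <;> simp [pow_succ']

/-- A Controlled-NOT writes the parity onto wire `j`, and a second one erases it. -/
lemma implDiag_T_pow_parity (hG : standardGates ⊆ G) {i j : ι} (h : i ≠ j) (k : ℕ) :
    ImplDiag G (1 + k + 1) (fun x : ι → Bool => if xor (x i) (x j) then omega8 ^ k else 1) := by
  have h1 := (implDiag_T_pow hG j k).conj (impl_cnot hG h) (cnotBit_cnotBit h)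
  simpa [cnotBit] using h1

/-- The doubly controlled sign. -/
lemma implDiag_ccz (hG : standardGates ⊆ G) {a b c : ι} (hab : a ≠ b) (hac : a ≠ c) (hbc : b ≠ c) :
    ImplDiag G 35 (fun x : ι → Bool => if x a && x b && x c then -1 else 1) := by
  -- Phase polynomial: 4abc = a + b + c - (a⊕b) - (a⊕c) - (b⊕c) + (a⊕b⊕c), with ω⁴ = -1 and ω⁷ =
  -- ω⁻¹. The term `h3` is the triple parity. Gates: 3·1 + 3·9 + 5 = 35.
  have h3 := (implDiag_T_pow_parity hG hbc 1).conj (impl_cnot hG hab) (cnotBit_cnotBit hab)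
  have h := ((((((implDiag_T_pow hG a 1).mul (implDiag_T_pow hG b 1)).mul
    (implDiag_T_pow hG c 1)).mul (implDiag_T_pow_parity hG hab 7)).mul
    (implDiag_T_pow_parity hG hac 7)).mul (implDiag_T_pow_parity hG hbc 7)).mul h3
  convert h using 2 with x
  have e1 : cnotBit a b x b = xor (x a) (x b) := by simp [cnotBit]
  have e2 : cnotBit a b x c = x c := by simp [cnotBit, hbc.symm]
  rw [e1, e2]
  have h4 := omega8_pow_four
  have h8 : omega8 ^ 8 = 1 := by rw [show 8 = 4 * 2 from rfl, pow_mul, h4]; norm_num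
  cases x a <;> cases x b <;> cases x c <;> simp <;>
    first
    | linear_combination -(1 + omega8 ^ 8) * h8
    | linear_combination -h4

end gates

/-! ## Multiply controlled phases -/

section controlled

variable {G : Set Gate} {ι : Type} [Fintype ι] [DecidableEq ι]

/-- A diagonal operator conjugated by a Hadamard gate. -/
lemma ImplDiag.hadamard_conj (hG : standardGates ⊆ G) {s : ℕ} {d : (ι → Bool) → ℂ}
    (hd : ImplDiag G s d) (i : ι) :
    Impl G (s + 2) (fun (ψ : (ι → Bool) → ℂ) x =>
      (d (Function.update x i false) + d (Function.update x i true)) / 2 * ψ x +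
      (d (Function.update x i false) - d (Function.update x i true)) / 2 * ψ (flipBit i x)) := by
  have h := (impl_hadamard hG i).comp (Impl.comp hd (impl_hadamard hG i))
  have h2 : ((Real.sqrt 2 : ℝ) : ℂ) ^ 2 = 2 := by
    rw [← Complex.ofReal_pow, Real.sq_sqrt (by norm_num)]; norm_num
  have h0 : ((Real.sqrt 2 : ℝ) : ℂ) ≠ 0 := by
    intro h; rw [h] at h2; norm_num at h2
  rw [show s + 2 = 1 + s + 1 by ring]
  convert h using 3 with ψ x
  have e1 : x = Function.update x i (x i) := (Function.update_eq_self i x).symm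
  have e2 : ∀ b c, Function.update (Function.update x i b) i c = Function.update x i c :=
    fun b c => Function.update_idem _ _ _
  simp only [flipBit, e2, Function.update_self]
  have e3 : ψ x = ψ (Function.update x i (x i)) := congrArg ψ e1
  rw [e3]
  generalize d (Function.update x i false) = d0
  generalize d (Function.update x i true) = d1
  cases hx : x i
  · simp only [Bool.not_false, if_true, Bool.false_eq_true, if_false]
    field_simp
    rw [h2]
    ring
  · simp only [Bool.not_true, if_true, Bool.false_eq_true, if_false]
    field_simp
    rw [h2]
    ring

/-- The action of a Toffoli gate with controls `a`, `b` and target `c` on strings. -/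
def toffoliBit (a b c : ι) (x : ι → Bool) : ι → Bool := Function.update x c (xor (x a && x b) (x c))

lemma toffoliBit_toffoliBit {a b c : ι} (hac : a ≠ c) (hbc : b ≠ c) (x : ι → Bool) :
    toffoliBit a b c (toffoliBit a b c x) = x := by
  simp [toffoliBit, hac, hbc]

/-- The doubly controlled sign becomes a Toffoli gate under Hadamard conjugation of its target. -/
lemma impl_toffoli (hG : standardGates ⊆ G) {a b c : ι} (hab : a ≠ b) (hac : a ≠ c) (hbc : b ≠ c) :
    Impl G 37 (fun (ψ : (ι → Bool) → ℂ) x => ψ (toffoliBit a b c x)) := by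
  have h := (implDiag_ccz hG hab hac hbc).hadamard_conj hG c
  convert h using 3 with ψ x
  simp only [Function.update_self, Function.update_of_ne hac, Function.update_of_ne hbc]
  cases hab : x a && x b
  · simp only [toffoliBit, hab, Bool.false_and, Bool.false_xor, Function.update_eq_self]
    norm_num
  · simp only [toffoliBit, hab, flipBit, Bool.true_xor]
    norm_num

/-- The phase `i` controlled by the conjunction of a list of wires, with clean ancillas. -/
lemma exists_implDiag_and (hG : standardGates ⊆ G) (ws : List ι) :
    ∀ (ancs : List ι) (c : ι), ws.length = ancs.length → (c :: (ws ++ ancs)).Nodup →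
      ∃ d : (ι → Bool) → ℂ, ImplDiag G (74 * ws.length + 2) d ∧
        ∀ x : ι → Bool, (∀ a ∈ ancs, x a = false) →
          d x = if x c = true ∧ ∀ w ∈ ws, x w = true then Complex.I else 1 := by
  induction ws with
  | nil =>
    intro ancs c _ _
    refine ⟨_, implDiag_T_pow hG c 2, fun x _ => ?_⟩
    simp [omega8_sq]
  | cons w ws ih =>
    rintro (_ | ⟨a, ancs⟩) c hlen hnd
    · simp at hlen
    have hnd' : (c :: w :: a :: (ws ++ ancs)).Nodup := by
      refine (List.Perm.nodup_iff ?_).mp hnd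
      simp only [List.cons_append]
      exact (List.perm_middle.cons w).cons c
    simp only [List.nodup_cons, List.mem_cons, not_or, List.mem_append] at hnd'
    obtain ⟨⟨hcw, hca, hcws, hcanc⟩, ⟨hwa, hwws, hwanc⟩, ⟨haws, haanc⟩, hnd''⟩ := hnd'
    obtain ⟨d, hd, hd'⟩ := ih ancs a (by simpa using hlen) (by
      rw [List.nodup_cons, List.mem_append]
      exact ⟨not_or.mpr ⟨haws, haanc⟩, hnd''⟩)
    -- The Toffoli gate writes w ∧ c onto the clean ancilla `a`, which replaces `c` as control for
    -- the remaining wires; the second one uncomputes it. Hence 74 = 2·37 gates per control, plus T²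
    -- = diag(1, i) at the end of the recursion.
    have h := hd.conj (impl_toffoli hG (Ne.symm hcw) hwa hca) (toffoliBit_toffoliBit hwa hca)
    refine ⟨fun x => d (toffoliBit w c a x), ?_, ?_⟩
    · convert h using 1
      rw [List.length_cons]; ring
    · intro x hx
      have hxa : x a = false := hx a (by simp)
      have e1 : ∀ b, b ≠ a → toffoliBit w c a x b = x b := fun b hb => Function.update_of_ne hb _ _
      have e2 : toffoliBit w c a x a = (x w && x c) := by simp [toffoliBit, hxa]
      simp only
      rw [hd' _ fun b hb => (e1 b (by rintro rfl; exact haanc hb)).trans (hx b (by simp [hb])), e2]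
      have e3 : (∀ v ∈ ws, toffoliBit w c a x v = true) ↔ ∀ v ∈ ws, x v = true := by
        refine forall_congr' fun v => forall_congr' fun hv => ?_
        rw [e1 v (by rintro rfl; exact haws hv)]
      refine if_congr ?_ rfl rfl
      rw [e3, Bool.and_eq_true, List.forall_mem_cons]
      tauto

end controlled

/-! ## Operators on states with clean ancillas -/

section clean

variable {G : Set Gate} {ι : Type} [Fintype ι] [DecidableEq ι]

/-- All the wires in `A` carry the bit `0`. -/
def Clean (A : Finset ι) (x : ι → Bool) : Prop := ∀ a ∈ A, x a = false

/-- The operator `F` is computed by a circuit of size at most `s` as long as the ancillas in `A` are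
clean. -/
def ImplOn (G : Set Gate) (A : Finset ι) (s : ℕ) (F : ((ι → Bool) → ℂ) → (ι → Bool) → ℂ) : Prop :=
  ∃ C : Circuit G ι, C.size ≤ s ∧
    ∀ ψ : (ι → Bool) → ℂ, (∀ x, ¬ Clean A x → ψ x = 0) → C.toMatrix *ᵥ ψ = F ψ

lemma ImplOn.mono {A : Finset ι} {s t : ℕ} {F : ((ι → Bool) → ℂ) → (ι → Bool) → ℂ}
    (h : ImplOn G A s F) (hst : s ≤ t) : ImplOn G A t F := by
  obtain ⟨C, hC, hF⟩ := h
  exact ⟨C, hC.trans hst, hF⟩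

lemma Impl.implOn {A : Finset ι} {s : ℕ} {F F' : ((ι → Bool) → ℂ) → (ι → Bool) → ℂ}
    (h : Impl G s F) (h' : ∀ ψ : (ι → Bool) → ℂ, (∀ x, ¬ Clean A x → ψ x = 0) → F ψ = F' ψ) :
    ImplOn G A s F' := by
  obtain ⟨C, hC, hF⟩ := h
  exact ⟨C, hC, fun ψ hψ => (hF ψ).trans (h' ψ hψ)⟩

lemma ImplOn.conj {A : Finset ι} {s t : ℕ} {F : ((ι → Bool) → ℂ) → (ι → Bool) → ℂ}
    {π : (ι → Bool) → (ι → Bool)} (h : ImplOn G A s F)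
    (hπ : Impl G t (fun (ψ : (ι → Bool) → ℂ) x => ψ (π x)))
    (hclean : ∀ x, Clean A (π x) → Clean A x) :
    ImplOn G A (t + s + t) (fun ψ x => F (fun y => ψ (π y)) (π x)) := by
  obtain ⟨C, hC, hF⟩ := h
  obtain ⟨D, hD, hDF⟩ := hπ
  refine ⟨D.seq (C.seq D), ?_, fun ψ hψ => ?_⟩
  · have e1 : (D.seq (C.seq D)).size = D.size + (C.seq D).size := List.length_append
    have e2 : (C.seq D).size = C.size + D.size := List.length_append
    omega
  · rw [Circuit.toMatrix_seq, Circuit.toMatrix_seq, ← Matrix.mulVec_mulVec, ← Matrix.mulVec_mulVec,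
      hDF, hDF, hF]
    exact fun x hx => hψ _ fun h => hx (hclean x h)

/-- The operator multiplying the amplitude at `y` by `i`. -/
def phaseAt (y : ι → Bool) (ψ : (ι → Bool) → ℂ) (z : ι → Bool) : ℂ :=
  if z = y then Complex.I * ψ z else ψ z

/-- A square root of NOT between the basis strings `x` and `y`. -/
def sqrtSwap (x y : ι → Bool) (ψ : (ι → Bool) → ℂ) (z : ι → Bool) : ℂ :=
  if z = x then (1 + Complex.I) / 2 * ψ x + (1 - Complex.I) / 2 * ψ y
  else if z = y then (1 + Complex.I) / 2 * ψ y + (1 - Complex.I) / 2 * ψ x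
  else ψ z

lemma sqrtSwap_comm {x y : ι → Bool} (h : x ≠ y) : sqrtSwap x y = sqrtSwap y x := by
  funext ψ z
  simp only [sqrtSwap]
  by_cases h1 : z = x
  · subst h1; simp [h]
  · simp [h1]

/-- Conjugating by an involution of strings moves the distinguished string, so it is enough to treat
one convenient string; `sqrtSwap_conj` plays the same role for pairs. -/
lemma phaseAt_conj {π : (ι → Bool) → (ι → Bool)} (hinv : ∀ x, π (π x) = x) (y : ι → Bool) :
    (fun ψ x => phaseAt (π y) (fun y => ψ (π y)) (π x)) = phaseAt y := by
  funext ψ z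
  have h : π z = π y ↔ z = y := (Function.LeftInverse.injective hinv).eq_iff
  simp only [phaseAt, hinv, h]

lemma sqrtSwap_conj {π : (ι → Bool) → (ι → Bool)} (hinv : ∀ x, π (π x) = x) (x y : ι → Bool) :
    (fun ψ z => sqrtSwap (π x) (π y) (fun y => ψ (π y)) (π z)) = sqrtSwap x y := by
  funext ψ z
  have h : ∀ y, π z = π y ↔ z = y := fun y => (Function.LeftInverse.injective hinv).eq_iff
  simp only [sqrtSwap, hinv, h]

/-- The string with bit `0` on the ancillas `A` and bit `1` elsewhere. -/
def topString (A : Finset ι) : ι → Bool := fun i => decide (i ∉ A)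

/-- The phase `i` on the string `topString A` can be implemented with clean ancillas. -/
def HasTopPhase (G : Set Gate) (A : Finset ι) (s : ℕ) : Prop :=
  ∃ d : (ι → Bool) → ℂ, ImplDiag G s d ∧
    ∀ x, Clean A x → d x = if x = topString A then Complex.I else 1

lemma clean_of_forall_ne {A : Finset ι} {π : (ι → Bool) → (ι → Bool)} {i : ι} (hi : i ∉ A)
    (h : ∀ x j, j ≠ i → π x j = x j) (x : ι → Bool) : Clean A (π x) ↔ Clean A x := by
  refine forall_congr' fun a => forall_congr' fun ha => ?_
  rw [h x a (by rintro rfl; exact hi ha)]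

/-- NOT gates on the `k` zero bits outside `A` carry `y` to `topString A`; each is applied before
and after the phase. -/
lemma implOn_phaseAt (hG : standardGates ⊆ G) {A : Finset ι} {s : ℕ} (hA : HasTopPhase G A s) :
    ∀ (k : ℕ) (y : ι → Bool), Clean A y →
      (Finset.univ.filter fun i => i ∉ A ∧ y i = false).card = k →
      ImplOn G A (s + 2 * k) (phaseAt y) := by
  intro k
  induction k with
  | zero =>
    intro y hy hk
    rw [Finset.card_eq_zero, Finset.filter_eq_empty_iff] at hk
    have hy' : y = topString A := by
      funext i
      by_cases hi : i ∈ A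
      · rw [hy i hi]; simp [topString, hi]
      · have := hk (Finset.mem_univ i)
        simp only [hi, not_false_eq_true, true_and, Bool.not_eq_false] at this
        simp [topString, hi, this]
    obtain ⟨d, hd, hd'⟩ := hA
    refine Impl.implOn hd fun ψ hψ => ?_
    funext z
    by_cases hz : Clean A z
    · simp only [hd' z hz, phaseAt, hy', ite_mul, one_mul]
    · simp [phaseAt, hψ z hz]
  | succ k ih =>
    intro y hy hk
    obtain ⟨i, hi⟩ := Finset.card_pos.mp (by rw [hk]; exact Nat.succ_pos k)
    obtain ⟨-, hiA, hyi⟩ := Finset.mem_filter.mp hi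
    have h1 : ∀ x j, j ≠ i → flipBit i x j = x j := fun x j hj => Function.update_of_ne hj _ _
    have h2 := ih (flipBit i y) ((clean_of_forall_ne hiA h1 y).mpr hy) (by
      refine (congrArg Finset.card ?_).trans
        ((Finset.card_erase_of_mem hi).trans (by rw [hk]; rfl))
      ext j
      by_cases hj : j = i
      · subst hj; simp [flipBit, hyi]
      · simp [h1 y j hj, hj])
    have h3 := h2.conj (impl_not hG i) fun x => (clean_of_forall_ne hiA h1 x).mp
    rw [phaseAt_conj (flipBit_flipBit i)] at h3
    exact h3.mono (by omega)

/-- Given strings that differ at `i`, one can set both bits `j` to one by two gates. -/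
lemma exists_fix_bit (hG : standardGates ⊆ G) {i j : ι} (hij : i ≠ j) {x y : ι → Bool}
    (hx : x i = false) (hy : y i = true) :
    ∃ π : (ι → Bool) → (ι → Bool), Impl G 2 (fun (ψ : (ι → Bool) → ℂ) x => ψ (π x)) ∧
      (∀ z, π (π z) = z) ∧ (∀ z k, k ≠ j → π z k = z k) ∧ π x j = true ∧ π y j = true := by
  have himp : ∀ {s F}, Impl G s F → s ≤ 2 → Impl (ι := ι) G 2 F :=
    fun h hs => ⟨h.choose, h.choose_spec.1.trans hs, h.choose_spec.2⟩
  cases hxj : x j <;> cases hyj : y j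
  · exact ⟨flipBit j, himp (impl_not hG j) (by norm_num), flipBit_flipBit j,
      fun z k hk => Function.update_of_ne hk _ _, by simp [flipBit, hxj], by simp [flipBit, hyj]⟩
  · refine ⟨fun z => cnotBit i j (flipBit j z), (impl_not hG j).comp (impl_cnot hG hij), ?_, ?_, ?_, ?_⟩
    · intro z
      simp [cnotBit, flipBit, hij]
    · intro z k hk
      simp [cnotBit, flipBit, hk]
    · simp [cnotBit, flipBit, hxj, hx, hij]
    · simp [cnotBit, flipBit, hyj, hy, hij]
  · exact ⟨cnotBit i j, himp (impl_cnot hG hij) (by norm_num), cnotBit_cnotBit hij,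
      fun z k hk => Function.update_of_ne hk _ _, by simp [cnotBit, hx, hxj],
      by simp [cnotBit, hy, hyj]⟩
  · exact ⟨id, himp impl_id (by norm_num), fun _ => rfl, fun _ _ _ => rfl, hxj, hyj⟩

/-- Two gates before and two after, controlled by the differing bit `i`, set another bit to 1 in
both strings. When only bit `i` differs, conjugating the top phase by a Hadamard on `i` gives the
square root of NOT, as H·diag(1,i)·H has entries (1±i)/2. -/
lemma implOn_sqrtSwap_aux (hG : standardGates ⊆ G) {A : Finset ι} {s : ℕ} (hA : HasTopPhase G A s)
    {i : ι} (hiA : i ∉ A) :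
    ∀ (k : ℕ) (x y : ι → Bool), Clean A x → Clean A y → x i = false → y i = true →
      (Finset.univ.filter fun j => j ∉ A ∧ j ≠ i ∧ ¬ (x j = true ∧ y j = true)).card = k →
      ImplOn G A (s + 2 + 4 * k) (sqrtSwap x y) := by
  intro k
  induction k with
  | zero =>
    intro x y hx hy hxi hyi hk
    rw [Finset.card_eq_zero, Finset.filter_eq_empty_iff] at hk
    have h0 : ∀ j, j ∉ A → j ≠ i → x j = true ∧ y j = true := by
      intro j hj hji
      by_contra h
      exact hk (Finset.mem_univ j) ⟨hj, hji, h⟩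
    have hy' : y = topString A := by
      funext j
      by_cases hj : j ∈ A
      · rw [hy j hj]; simp [topString, hj]
      · by_cases hji : j = i
        · subst hji; simp [topString, hj, hyi]
        · simp [topString, hj, (h0 j hj hji).2]
    have hx' : x = flipBit i y := by
      funext j
      by_cases hji : j = i
      · subst hji; simp [flipBit, hxi, hyi]
      · rw [flipBit, Function.update_of_ne hji]
        by_cases hj : j ∈ A
        · rw [hx j hj, hy j hj]
        · rw [(h0 j hj hji).1, (h0 j hj hji).2]
    have hyx : y = flipBit i x := by rw [hx', flipBit_flipBit]
    have hne : x ≠ y := by rintro rfl; simp [hxi] at hyi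
    obtain ⟨d, hd, hd'⟩ := hA
    refine Impl.implOn (hd.hadamard_conj hG i) fun ψ hψ => ?_
    funext z
    have hu : ∀ (b : Bool) (w : ι → Bool) (j : ι), j ≠ i → Function.update w i b j = w j :=
      fun b w j hj => Function.update_of_ne hj _ _
    by_cases hz : Clean A z
    · have e0 : d (Function.update z i false) = 1 := by
        rw [hd' _ ((clean_of_forall_ne hiA (hu false) z).mpr hz), if_neg]
        intro h
        have := congrFun h i
        simp [topString, hiA] at this
      have e1 : d (Function.update z i true) = if Function.update z i true = y then Complex.I else 1 := by
        rw [hd' _ ((clean_of_forall_ne hiA (hu true) z).mpr hz), hy']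
      rw [e0, e1, sqrtSwap]
      by_cases hzx : z = x
      · subst hzx
        have e2 : Function.update z i true = y := by rw [hyx, flipBit, hxi]; rfl
        rw [if_pos e2, if_pos rfl, ← hyx]
      · rw [if_neg hzx]
        by_cases hzy : z = y
        · subst hzy
          have e2 : Function.update z i true = z := by
            rw [← hyi]; exact Function.update_eq_self i z
          rw [if_pos e2, if_pos rfl, ← hx']
        · have e2 : Function.update z i true ≠ y := by
            intro h
            cases hzi : z i
            · apply hzx
              rw [hx', ← h, flipBit, Function.update_self, Function.update_idem, Bool.not_true,
                ← hzi, Function.update_eq_self]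
            · apply hzy
              rw [← h, ← hzi, Function.update_eq_self]
          rw [if_neg hzy, if_neg e2]
          ring
    · have hfz : ¬ Clean A (flipBit i z) := by
        rwa [flipBit, clean_of_forall_ne hiA (π := fun w => Function.update w i (!z i)) (hu _) z]
      have hzx : z ≠ x := by rintro rfl; exact hz hx
      have hzy : z ≠ y := by rintro rfl; exact hz hy
      simp [sqrtSwap, hzx, hzy, hψ z hz, hψ _ hfz]
  | succ k ih =>
    intro x y hx hy hxi hyi hk
    obtain ⟨j, hj⟩ := Finset.card_pos.mp (by rw [hk]; exact Nat.succ_pos k)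
    obtain ⟨-, hjA, hji, -⟩ := Finset.mem_filter.mp hj
    obtain ⟨π, hπ, hinv, hπj, hπx, hπy⟩ := exists_fix_bit hG hji.symm hxi hyi
    have h2 := ih (π x) (π y) ((clean_of_forall_ne hjA hπj x).mpr hx)
      ((clean_of_forall_ne hjA hπj y).mpr hy) ((hπj x i hji.symm).trans hxi)
      ((hπj y i hji.symm).trans hyi) (by
        refine (congrArg Finset.card ?_).trans
          ((Finset.card_erase_of_mem hj).trans (by rw [hk]; rfl))
        ext l
        by_cases hl : l = j
        · subst hl; simp [hπx, hπy]
        · simp [hπj x l hl, hπj y l hl, hl])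
    have h3 := h2.conj hπ fun z => (clean_of_forall_ne hjA hπj z).mp
    rw [sqrtSwap_conj hinv] at h3
    exact h3.mono (by omega)

lemma implOn_phaseAt_card (hG : standardGates ⊆ G) {A : Finset ι} {s : ℕ} (hA : HasTopPhase G A s)
    {y : ι → Bool} (hy : Clean A y) :
    ImplOn G A (s + 2 + 4 * Fintype.card ι) (phaseAt y) := by
  refine (implOn_phaseAt hG hA _ y hy rfl).mono ?_
  have := Finset.card_le_univ (Finset.univ.filter fun i => i ∉ A ∧ y i = false)
  omega

lemma implOn_sqrtSwap (hG : standardGates ⊆ G) {A : Finset ι} {s : ℕ} (hA : HasTopPhase G A s)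
    {x y : ι → Bool} (hx : Clean A x) (hy : Clean A y) (hxy : x ≠ y) :
    ImplOn G A (s + 2 + 4 * Fintype.card ι) (sqrtSwap x y) := by
  obtain ⟨i, hi⟩ := Function.ne_iff.mp hxy
  have hiA : i ∉ A := fun h => hi (by rw [hx i h, hy i h])
  cases hxi : x i
  · have hyi : y i = true := by cases h : y i <;> simp_all
    refine (implOn_sqrtSwap_aux hG hA hiA _ x y hx hy hxi hyi rfl).mono ?_
    have := Finset.card_le_univ
      (Finset.univ.filter fun j => j ∉ A ∧ j ≠ i ∧ ¬ (x j = true ∧ y j = true))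
    omega
  · have hyi : y i = false := by cases h : y i <;> simp_all
    rw [sqrtSwap_comm hxy]
    refine (implOn_sqrtSwap_aux hG hA hiA _ y x hy hx hyi hxi rfl).mono ?_
    have := Finset.card_le_univ
      (Finset.univ.filter fun j => j ∉ A ∧ j ≠ i ∧ ¬ (y j = true ∧ x j = true))
    omega

end clean

/-! ## Exact preparation of states with Gaussian integer amplitudes -/

section prep

variable {G : Set Gate} {ι : Type} [Fintype ι] [DecidableEq ι]

/-- The vector `ψ` is prepared, up to a phase, by a circuit of size at most `s`. -/
def Prep (G : Set Gate) (s : ℕ) (ψ : (ι → Bool) → ℂ) : Prop :=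
  ∃ C : Circuit G ι, C.size ≤ s ∧ ∃ u : ℂ, ‖u‖ = 1 ∧ C.state = u • ψ

lemma Prep.mono {s t : ℕ} {ψ : (ι → Bool) → ℂ} (h : Prep G s ψ) (hst : s ≤ t) : Prep G t ψ := by
  obtain ⟨C, hC, hu⟩ := h
  exact ⟨C, hC.trans hst, hu⟩

lemma Prep.smul {s : ℕ} {ψ : (ι → Bool) → ℂ} (h : Prep G s ψ) {v : ℂ} (hv : ‖v‖ = 1) :
    Prep G s (v • ψ) := by
  obtain ⟨C, hC, u, hu, hψ⟩ := h
  refine ⟨C, hC, u * v⁻¹, by rw [norm_mul, norm_inv, hu, hv]; norm_num, ?_⟩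
  have hv0 : v ≠ 0 := norm_ne_zero_iff.mp (by rw [hv]; norm_num)
  rw [hψ, smul_smul, mul_assoc, inv_mul_cancel₀ hv0, mul_one]

lemma Prep.apply {A : Finset ι} {s t : ℕ} {ψ : (ι → Bool) → ℂ} (h : Prep G s ψ)
    (hψ : ∀ x, ¬ Clean A x → ψ x = 0) {F : ((ι → Bool) → ℂ) → (ι → Bool) → ℂ}
    (hF : ImplOn G A t F) : Prep G (s + t) (F ψ) := by
  obtain ⟨C, hC, u, hu, hCψ⟩ := h
  obtain ⟨D, hD, hDF⟩ := hF
  refine ⟨C.seq D, (List.length_append (as := C) (bs := D)).trans_le (Nat.add_le_add hC hD),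
    u, hu, ?_⟩
  rw [Circuit.state, Circuit.toMatrix_seq, ← Matrix.mulVec_mulVec, ← hDF ψ hψ, ← Matrix.mulVec_smul,
    ← hCψ, Circuit.state]

lemma prep_single (hG : standardGates ⊆ G) :
    ∀ (k : ℕ) (y : ι → Bool), (Finset.univ.filter fun i => y i = true).card = k →
      Prep G k (Pi.single y 1 : (ι → Bool) → ℂ) := by
  intro k
  induction k with
  | zero =>
    intro y hk
    rw [Finset.card_eq_zero, Finset.filter_eq_empty_iff] at hk
    have hy : y = fun _ => false := by
      funext i
      simpa using hk (Finset.mem_univ i)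
    refine ⟨([] : List _), le_rfl, 1, norm_one, ?_⟩
    rw [hy, one_smul]
    exact Matrix.one_mulVec _
  | succ k ih =>
    intro y hk
    obtain ⟨i, hi⟩ := Finset.card_pos.mp (by rw [hk]; exact Nat.succ_pos k)
    have hyi : y i = true := (Finset.mem_filter.mp hi).2
    have h2 := ih (flipBit i y) (by
      refine (congrArg Finset.card ?_).trans
        ((Finset.card_erase_of_mem hi).trans (by rw [hk]; rfl))
      ext j
      by_cases hj : j = i
      · subst hj; simp [flipBit, hyi]
      · rw [Finset.mem_erase, Finset.mem_filter, Finset.mem_filter, flipBit,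
          Function.update_of_ne hj]
        simp [hj])
    have h3 := h2.apply (A := ∅) (fun x hx => absurd (by simp [Clean]) hx)
      ((impl_not hG i).implOn fun ψ _ => rfl)
    convert h3 using 1
    funext z
    have : flipBit i z = flipBit i y ↔ z = y :=
      (Function.LeftInverse.injective (flipBit_flipBit i)).eq_iff
    simp only [Pi.single_apply, this]

/-- A pair of integers as a Gaussian integer. -/
def gaussToComplex (z : ℤ × ℤ) : ℂ := z.1 + z.2 * Complex.I

/-- The state with amplitudes `w x / √2 ^ k`. -/
def gaussVec (k : ℕ) (w : (ι → Bool) → ℤ × ℤ) (x : ι → Bool) : ℂ :=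
  gaussToComplex (w x) / (Real.sqrt 2 : ℂ) ^ k

/-- The norm of a Gaussian integer. -/
def gaussNorm (z : ℤ × ℤ) : ℤ := z.1 ^ 2 + z.2 ^ 2

lemma gaussNorm_nonneg (z : ℤ × ℤ) : 0 ≤ gaussNorm z := by unfold gaussNorm; positivity

lemma gaussNorm_eq_zero {z : ℤ × ℤ} (h : gaussNorm z = 0) : z = 0 := by
  unfold gaussNorm at h
  have h1 : z.1 ^ 2 = 0 := by nlinarith [sq_nonneg z.1, sq_nonneg z.2]
  have h2 : z.2 ^ 2 = 0 := by nlinarith [sq_nonneg z.1, sq_nonneg z.2]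
  exact Prod.ext (by simpa using h1) (by simpa using h2)

lemma sq_norm_gaussToComplex (z : ℤ × ℤ) : ‖gaussToComplex z‖ ^ 2 = gaussNorm z := by
  rw [← Complex.normSq_eq_norm_sq, Complex.normSq_apply, gaussToComplex, gaussNorm]
  simp
  ring

/-- A Gaussian integer not divisible by `1 + i`. -/
def GaussOdd (z : ℤ × ℤ) : Prop := Odd (z.1 + z.2)

instance : DecidablePred GaussOdd := fun z => inferInstanceAs (Decidable (Odd (z.1 + z.2)))

lemma even_gaussNorm_iff (z : ℤ × ℤ) : Even (gaussNorm z) ↔ ¬ GaussOdd z := by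
  rw [gaussNorm, GaussOdd, Int.not_odd_iff_even]
  simp [Int.even_add, Int.even_pow]

/-- Two odd Gaussian integers that are congruent up to a factor `i` come from two even ones by a
square root of NOT. -/
lemma exists_sqrtSwap_preimage {z w : ℤ × ℤ} (hz : GaussOdd z) (hw : GaussOdd w)
    (h3 : Even (z.2 + w.1)) : ∃ a b : ℤ × ℤ, ¬ GaussOdd a ∧ ¬ GaussOdd b ∧
      gaussNorm a + gaussNorm b = gaussNorm z + gaussNorm w ∧
      (1 + Complex.I) / 2 * gaussToComplex a + (1 - Complex.I) / 2 * gaussToComplex b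
        = gaussToComplex z ∧
      (1 + Complex.I) / 2 * gaussToComplex b + (1 - Complex.I) / 2 * gaussToComplex a
        = gaussToComplex w := by
  obtain ⟨p, q⟩ := z
  obtain ⟨r, s⟩ := w
  obtain ⟨u, hu⟩ := hz
  obtain ⟨v, hv⟩ := hw
  obtain ⟨t, ht⟩ := h3
  simp only at hu hv ht
  -- The inverse square root of NOT: a = ((1-i)z + (1+i)w)/2 and b = ((1+i)z + (1-i)w)/2. The
  -- coordinate sums are q + r and p + s, even by the parity hypotheses.
  obtain ⟨a1, ha1⟩ : ∃ a, p + q + r - s = 2 * a := ⟨(p + q + r - s) / 2, by omega⟩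
  obtain ⟨a2, ha2⟩ : ∃ a, q - p + r + s = 2 * a := ⟨(q - p + r + s) / 2, by omega⟩
  obtain ⟨b1, hb1⟩ : ∃ a, r + s + p - q = 2 * a := ⟨(r + s + p - q) / 2, by omega⟩
  obtain ⟨b2, hb2⟩ : ∃ a, s - r + p + q = 2 * a := ⟨(s - r + p + q) / 2, by omega⟩
  have e1 : ((a1 - a2 + b1 + b2 : ℤ) : ℂ) = (2 * p : ℤ) := by congr 1; omega
  have e2 : ((a1 + a2 - b1 + b2 : ℤ) : ℂ) = (2 * q : ℤ) := by congr 1; omega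
  have e3 : ((b1 - b2 + a1 + a2 : ℤ) : ℂ) = (2 * r : ℤ) := by congr 1; omega
  have e4 : ((b1 + b2 - a1 + a2 : ℤ) : ℂ) = (2 * s : ℤ) := by congr 1; omega
  push_cast at e1 e2 e3 e4
  refine ⟨(a1, a2), (b1, b2), ?_, ?_, ?_, ?_, ?_⟩
  · rw [GaussOdd, Int.not_odd_iff_even]
    exact ⟨t, by simp only; omega⟩
  · rw [GaussOdd, Int.not_odd_iff_even]
    exact ⟨u + v + 1 - t, by simp only; omega⟩
  · simp only [gaussNorm]
    have : 4 * (a1 ^ 2 + a2 ^ 2 + (b1 ^ 2 + b2 ^ 2)) = 4 * (p ^ 2 + q ^ 2 + (r ^ 2 + s ^ 2)) := by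
      linear_combination -(p + q + r - s + 2 * a1) * ha1 - (q - p + r + s + 2 * a2) * ha2
        - (r + s + p - q + 2 * b1) * hb1 - (s - r + p + q + 2 * b2) * hb2
    linarith
  · simp only [gaussToComplex]
    linear_combination (1 / 2) * e1 + (Complex.I / 2) * e2 + (a2 - b2) / 2 * Complex.I_sq
  · simp only [gaussToComplex]
    linear_combination (1 / 2) * e3 + (Complex.I / 2) * e4 + (b2 - a2) / 2 * Complex.I_sq

lemma sum_two_updates {M X : Type*} [AddCommMonoid M] [Fintype X] [DecidableEq X]
    (f g : X → M) {x y : X} (hxy : x ≠ y) (h : ∀ z, z ≠ x → z ≠ y → f z = g z)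
    (h2 : f x + f y = g x + g y) : ∑ z, f z = ∑ z, g z := by
  have e : ∀ f : X → M, ∑ z, f z = (f x + f y) + ∑ z ∈ (Finset.univ.erase x).erase y, f z := by
    intro f
    rw [← Finset.add_sum_erase _ f (Finset.mem_univ x),
      ← Finset.add_sum_erase _ f (Finset.mem_erase.mpr ⟨hxy.symm, Finset.mem_univ y⟩), add_assoc]
  rw [e f, e g, h2]
  congr 1
  refine Finset.sum_congr rfl fun z hz => ?_
  simp only [Finset.mem_erase] at hz
  exact h z hz.2.1 hz.1

lemma norm_one_add_I_div : ‖(1 + Complex.I) / (Real.sqrt 2 : ℂ)‖ = 1 := by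
  have h : ‖(1 + Complex.I)‖ = Real.sqrt 2 := by
    rw [Complex.norm_def, Complex.normSq_apply]; norm_num
  rw [norm_div, h, Complex.norm_real, Real.norm_of_nonneg (Real.sqrt_nonneg _), div_self]
  positivity

/-- One pairing step: the number of odd entries decreases by two. -/
lemma prep_pair (hG : standardGates ⊆ G) {A : Finset ι} {s c k b : ℕ} (hA : HasTopPhase G A s)
    (hc : s + 2 + 4 * Fintype.card ι ≤ c) {w : (ι → Bool) → ℤ × ℤ}
    (hw : ∀ x, ¬ Clean A x → w x = 0) {x y : ι → Bool} (hxy : x ≠ y) (hx : GaussOdd (w x))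
    (hy : GaussOdd (w y)) (h3 : Even ((w x).2 + (w y).1))
    (ih : ∀ w' : (ι → Bool) → ℤ × ℤ, (∀ x, ¬ Clean A x → w' x = 0) →
      ∑ x, gaussNorm (w' x) = ∑ x, gaussNorm (w x) →
      (Finset.univ.filter fun x => GaussOdd (w' x)).card + 2
        = (Finset.univ.filter fun x => GaussOdd (w x)).card → Prep G b (gaussVec k w')) :
    Prep G (b + c) (gaussVec k w) := by
  have hclean : ∀ x, GaussOdd (w x) → Clean A x := by
    intro x hx
    by_contra h
    rw [hw x h] at hx
    simp [GaussOdd] at hx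
  obtain ⟨a, a', ha, ha', hn, e1, e2⟩ := exists_sqrtSwap_preimage hx hy h3
  set w' : (ι → Bool) → ℤ × ℤ := fun z => if z = x then a else if z = y then a' else w z with hw'
  have hwx : w' x = a := by simp [hw']
  have hwy : w' y = a' := by simp [hw', hxy.symm]
  have hwz : ∀ z, z ≠ x → z ≠ y → w' z = w z := fun z h1 h2 => by simp [hw', h1, h2]
  have hw0 : ∀ z, ¬ Clean A z → w' z = 0 := by
    intro z hz
    rw [hwz z (by rintro rfl; exact hz (hclean _ hx)) (by rintro rfl; exact hz (hclean _ hy)), hw z hz]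
  have h := (ih w' hw0 ?_ ?_).apply (A := A) (fun z hz => by simp [gaussVec, hw0 z hz, gaussToComplex])
    ((implOn_sqrtSwap hG hA (hclean x hx) (hclean y hy) hxy).mono hc)
  · convert h using 1
    funext z
    simp only [sqrtSwap, gaussVec, hwx, hwy]
    by_cases hzx : z = x
    · subst hzx
      rw [if_pos rfl, ← e1]; ring
    · rw [if_neg hzx]
      by_cases hzy : z = y
      · subst hzy
        rw [if_pos rfl, ← e2]; ring
      · rw [if_neg hzy, hwz z hzx hzy]
  · refine sum_two_updates _ _ hxy (fun z h1 h2 => by rw [hwz z h1 h2]) ?_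
    rw [hwx, hwy, hn]
  · have e : Finset.univ.filter (fun z => GaussOdd (w' z))
        = ((Finset.univ.filter fun z => GaussOdd (w z)).erase x).erase y := by
      ext z
      simp only [Finset.mem_filter, Finset.mem_univ, true_and, Finset.mem_erase]
      by_cases hzx : z = x
      · subst hzx; simp [hwx, ha]
      · by_cases hzy : z = y
        · subst hzy; simp [hwy, ha']
        · simp [hwz z hzx hzy, hzx, hzy]
    have hx' : x ∈ Finset.univ.filter fun z => GaussOdd (w z) := by simp [hx]
    have hy' : y ∈ (Finset.univ.filter fun z => GaussOdd (w z)).erase x := by simp [hy, hxy.symm]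
    rw [e, ← Finset.card_erase_add_one hx', ← Finset.card_erase_add_one hy']

/-- Multiplication of one entry by `-i`. -/
lemma prep_phase (hG : standardGates ⊆ G) {A : Finset ι} {s c k b : ℕ} (hA : HasTopPhase G A s)
    (hc : s + 2 + 4 * Fintype.card ι ≤ c) {w : (ι → Bool) → ℤ × ℤ}
    (hw : ∀ x, ¬ Clean A x → w x = 0) {y : ι → Bool} (hy : Clean A y)
    (h : Prep G b (gaussVec k (Function.update w y ((w y).2, -(w y).1)))) :
    Prep G (b + c) (gaussVec k w) := by
  have h2 := h.apply (A := A) (fun z hz => by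
    rw [gaussVec, Function.update_of_ne (by rintro rfl; exact hz hy), hw z hz]
    simp [gaussToComplex]) ((implOn_phaseAt_card hG hA hy).mono hc)
  convert h2 using 1
  funext z
  simp only [phaseAt, gaussVec]
  by_cases hz : z = y
  · subst hz
    rw [if_pos rfl, Function.update_self]
    simp only [gaussToComplex]
    rw [← mul_div_assoc]
    congr 1
    push_cast
    linear_combination ((w z).1 : ℂ) * Complex.I_sq
  · rw [if_neg hz, Function.update_of_ne hz]

/-- An entry is odd exactly when its norm is, so an even total norm cannot have a single odd entry.
-/
lemma exists_ne_odd {w : (ι → Bool) → ℤ × ℤ} (hsum : Even (∑ x, gaussNorm (w x))) {x : ι → Bool}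
    (hx : GaussOdd (w x)) : ∃ y, x ≠ y ∧ GaussOdd (w y) := by
  by_contra! h
  rw [← Finset.add_sum_erase _ _ (Finset.mem_univ x), Int.even_add] at hsum
  refine (even_gaussNorm_iff _).mp (hsum.mpr ?_) hx
  refine Finset.even_sum _ fun y hy => ?_
  rw [even_gaussNorm_iff]
  exact h y (Finset.ne_of_mem_erase hy).symm

/-- One level of the descent. Two odd entries are removed by at most two moves of cost `c`, so `t`
of them cost at most t·c. With none left, all entries are divisible by 1+i, and the leftover unit
(1+i)/√2 is a global phase, which `Prep` ignores. -/
lemma prep_step (hG : standardGates ⊆ G) {A : Finset ι} {s c k b : ℕ} (hA : HasTopPhase G A s)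
    (hc : s + 2 + 4 * Fintype.card ι ≤ c)
    (ih : ∀ w : (ι → Bool) → ℤ × ℤ, (∀ x, ¬ Clean A x → w x = 0) →
      ∑ x, gaussNorm (w x) = 2 ^ k → Prep G b (gaussVec k w)) :
    ∀ (t : ℕ) (w : (ι → Bool) → ℤ × ℤ), (∀ x, ¬ Clean A x → w x = 0) →
      ∑ x, gaussNorm (w x) = 2 ^ (k + 1) →
      (Finset.univ.filter fun x => GaussOdd (w x)).card = t →
      Prep G (b + t * c) (gaussVec (k + 1) w) := by
  intro t
  induction t using Nat.strong_induction_on with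
  | _ t iht =>
  intro w hw hsum ht
  have heven : Even (∑ x, gaussNorm (w x)) := by rw [hsum, pow_succ]; exact even_two.mul_left _
  by_cases hex : ∃ x, GaussOdd (w x)
  · obtain ⟨x, hx⟩ := hex
    obtain ⟨y, hxy, hy⟩ := exists_ne_odd heven hx
    have hycl : Clean A y := by
      by_contra h
      rw [hw y h] at hy
      simp [GaussOdd] at hy
    have main : ∀ v : (ι → Bool) → ℤ × ℤ, (∀ x, ¬ Clean A x → v x = 0) →
        ∑ x, gaussNorm (v x) = 2 ^ (k + 1) →
        (Finset.univ.filter fun x => GaussOdd (v x)).card = t →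
        GaussOdd (v x) → GaussOdd (v y) → Even ((v x).2 + (v y).1) →
        Prep G (b + (t - 2) * c + c) (gaussVec (k + 1) v) ∧ 2 ≤ t := by
      intro v hv hvs hvt hvx hvy hvxy
      have h2 : 2 ≤ t := by
        rw [← hvt]
        refine Nat.succ_le_iff.mpr (Finset.one_lt_card.mpr ⟨x, by simp [hvx], y, by simp [hvy], hxy⟩)
      refine ⟨prep_pair hG hA hc hv hxy hvx hvy hvxy fun w' h0 h1 hcard => ?_, h2⟩
      rw [hvt] at hcard
      exact iht (t - 2) (by omega) w' h0 (h1.trans hvs) (by omega)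
    have fin : ∀ {j}, Prep G j (gaussVec (k + 1) w) → 2 ≤ t → j ≤ b + (t - 2) * c + c + c →
        Prep G (b + t * c) (gaussVec (k + 1) w) := by
      intro j hj h2 hle
      refine hj.mono (hle.trans ?_)
      obtain ⟨t', rfl⟩ := Nat.exists_eq_add_of_le h2
      rw [Nat.add_sub_cancel_left]
      nlinarith
    by_cases hpar : Even ((w x).2 + (w y).1)
    · obtain ⟨h1, h2⟩ := main w hw hsum ht hx hy hpar
      exact fin h1 h2 (by omega)
    -- Multiplying the entry at `y` by -i brings its imaginary part into first place, and that has
    -- the opposite parity because the entry is odd.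
    · have hvz : ∀ z, z ≠ y → Function.update w y ((w y).2, -(w y).1) z = w z :=
        fun z hz => Function.update_of_ne hz _ _
      have hodd : GaussOdd ((w y).2, -(w y).1) := by
        simp only [GaussOdd] at hy ⊢
        rw [Int.odd_iff] at hy ⊢
        omega
      have h := main (Function.update w y ((w y).2, -(w y).1)) ?_ ?_ ?_ ?_ ?_ ?_
      · exact fin (prep_phase hG hA hc hw hycl h.1) h.2 le_rfl
      · intro z hz
        rw [hvz z (by rintro rfl; exact hz hycl), hw z hz]
      · rw [← hsum]
        refine Finset.sum_congr rfl fun z _ => ?_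
        by_cases hz : z = y
        · subst hz; rw [Function.update_self]; simp only [gaussNorm]; ring
        · rw [hvz z hz]
      · rw [← ht]
        congr 1
        ext z
        by_cases hz : z = y
        · subst hz; simp [hodd, hy]
        · simp [hvz z hz]
      · rwa [hvz x hxy]
      · rwa [Function.update_self]
      · rw [hvz x hxy, Function.update_self]
        simp only [GaussOdd] at hx hy
        rw [Int.even_iff] at hpar ⊢
        rw [Int.odd_iff] at hx hy
        omega
  · push Not at hex
    -- `v` is the quotient of `w` by 1+i.
    have hhalf : ∀ z, ∃ v : ℤ × ℤ, (w z).1 + (w z).2 = 2 * v.1 ∧ (w z).2 - (w z).1 = 2 * v.2 := by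
      intro z
      have := hex z
      rw [GaussOdd, Int.not_odd_iff_even, Int.even_iff] at this
      exact ⟨(((w z).1 + (w z).2) / 2, ((w z).2 - (w z).1) / 2), by simp only; omega,
        by simp only; omega⟩
    choose v hv1 hv2 using hhalf
    have hvn : ∀ z, gaussNorm (w z) = 2 * gaussNorm (v z) := by
      intro z
      have e1 : (w z).1 = (v z).1 - (v z).2 := by have := hv1 z; have := hv2 z; omega
      have e2 : (w z).2 = (v z).1 + (v z).2 := by have := hv1 z; have := hv2 z; omega
      simp only [gaussNorm, e1, e2]; ring
    have h := (ih v ?_ ?_).smul norm_one_add_I_div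
    · refine Prep.mono ?_ (Nat.le_add_right b _)
      convert h using 1
      funext z
      have e1 : ((w z).1 : ℂ) = (v z).1 - (v z).2 := by
        have : (w z).1 = (v z).1 - (v z).2 := by have := hv1 z; have := hv2 z; omega
        rw [this]; push_cast; ring
      have e2 : ((w z).2 : ℂ) = (v z).1 + (v z).2 := by
        have : (w z).2 = (v z).1 + (v z).2 := by have := hv1 z; have := hv2 z; omega
        rw [this]; push_cast; ring
      rw [Pi.smul_apply, smul_eq_mul, gaussVec, gaussVec, div_mul_div_comm, ← pow_succ']
      congr 1
      rw [gaussToComplex, gaussToComplex, e1, e2]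
      linear_combination -((v z).2 : ℂ) * Complex.I_sq
    · intro z hz
      apply gaussNorm_eq_zero
      have := hvn z
      rw [hw z hz] at this
      simp only [gaussNorm, Prod.fst_zero, Prod.snd_zero] at this ⊢
      linarith
    · rw [Finset.sum_congr rfl fun z _ => hvn z, ← Finset.mul_sum, pow_succ'] at hsum
      exact mul_left_cancel₀ two_ne_zero hsum

/-- Unit vectors with entries in `ℤ[i] / √2 ^ k` on clean strings can be prepared exactly. -/
theorem prep_gaussVec (hG : standardGates ⊆ G) {A : Finset ι} {s N : ℕ} (hA : HasTopPhase G A s)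
    (hN : ∀ T : Finset (ι → Bool), (∀ x ∈ T, Clean A x) → T.card ≤ N) :
    ∀ (k : ℕ) (w : (ι → Bool) → ℤ × ℤ), (∀ x, ¬ Clean A x → w x = 0) →
      ∑ x, gaussNorm (w x) = 2 ^ k →
      Prep G (Fintype.card ι + k * (N * (s + 2 + 4 * Fintype.card ι))) (gaussVec k w) := by
  intro k
  induction k with
  | zero =>
    intro w hw hsum
    rw [pow_zero] at hsum
    -- Nonnegative integers with sum 1: one entry is a unit and the others vanish, so the state is a
    -- basis string up to a phase.
    obtain ⟨x, hx⟩ : ∃ x, gaussNorm (w x) ≠ 0 := by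
      by_contra! h
      rw [Finset.sum_eq_zero fun x _ => h x] at hsum
      exact zero_ne_one hsum
    rw [← Finset.add_sum_erase _ _ (Finset.mem_univ x)] at hsum
    have h1 : 0 ≤ ∑ z ∈ Finset.univ.erase x, gaussNorm (w z) :=
      Finset.sum_nonneg fun z _ => gaussNorm_nonneg _
    have h2 := gaussNorm_nonneg (w x)
    have h3 : gaussNorm (w x) = 1 := by omega
    have h4 : ∑ z ∈ Finset.univ.erase x, gaussNorm (w z) = 0 := by omega
    rw [Finset.sum_eq_zero_iff_of_nonneg fun z _ => gaussNorm_nonneg _] at h4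
    have h5 : ‖gaussToComplex (w x)‖ = 1 := by
      have := sq_norm_gaussToComplex (w x)
      rw [h3, Int.cast_one] at this
      rwa [pow_eq_one_iff_of_nonneg (norm_nonneg _) two_ne_zero] at this
    have h6 := (prep_single hG _ x rfl).smul h5
    have h7 : gaussVec 0 w = gaussToComplex (w x) • (Pi.single x 1 : (ι → Bool) → ℂ) := by
      funext z
      rw [gaussVec, pow_zero, div_one, Pi.smul_apply, smul_eq_mul]
      by_cases hz : z = x
      · subst hz; simp
      · rw [gaussNorm_eq_zero (h4 z (by simp [hz])), Pi.single_eq_of_ne hz]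
        simp [gaussToComplex]
    rw [h7]
    exact h6.mono ((Finset.card_le_univ _).trans (Nat.le_add_right _ _))
  | succ k ih =>
    intro w hw hsum
    refine (prep_step hG hA le_rfl ih _ w hw hsum rfl).mono ?_
    have : (Finset.univ.filter fun x => GaussOdd (w x)).card ≤ N := by
      refine hN _ fun x hx => ?_
      by_contra h
      rw [Finset.mem_filter, hw x h] at hx
      simp [GaussOdd] at hx
    have := Nat.mul_le_mul_right (s + 2 + 4 * Fintype.card ι) this
    rw [Nat.succ_mul k, ← add_assoc]
    exact Nat.add_le_add_left this _

end prep

/-! ## Approximation of arbitrary states -/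

/-- Rounding towards zero never increases the norm, so the deficit to be filled later is
nonnegative. -/
lemma exists_int_round (a : ℝ) : ∃ z : ℤ, (z : ℝ) ^ 2 ≤ a ^ 2 ∧ |a - z| ≤ 1 := by
  rcases le_total 0 a with h | h
  · refine ⟨⌊a⌋, ?_, ?_⟩
    · have h0 : (0 : ℝ) ≤ ⌊a⌋ := by exact_mod_cast Int.floor_nonneg.mpr h
      exact pow_le_pow_left₀ h0 (Int.floor_le a) 2
    · rw [abs_of_nonneg (sub_nonneg.mpr (Int.floor_le a))]
      linarith [Int.lt_floor_add_one a]
  · refine ⟨⌈a⌉, ?_, ?_⟩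
    · have h0 : (⌈a⌉ : ℝ) ≤ 0 := by exact_mod_cast Int.ceil_le.mpr (by exact_mod_cast h)
      have := Int.le_ceil a
      nlinarith
    · rw [abs_of_nonpos (sub_nonpos.mpr (Int.le_ceil a))]
      linarith [Int.ceil_lt_add_one a]

lemma exists_gauss_round (z : ℂ) :
    ∃ w : ℤ × ℤ, (gaussNorm w : ℝ) ≤ ‖z‖ ^ 2 ∧ ‖gaussToComplex w - z‖ ≤ 2 := by
  obtain ⟨a, ha, ha'⟩ := exists_int_round z.re
  obtain ⟨b, hb, hb'⟩ := exists_int_round z.im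
  refine ⟨(a, b), ?_, ?_⟩
  · rw [← Complex.normSq_eq_norm_sq, Complex.normSq_apply, gaussNorm]
    push_cast
    linarith
  · refine (Complex.norm_le_abs_re_add_abs_im _).trans ?_
    rw [abs_sub_comm] at ha' hb'
    have e1 : (gaussToComplex (a, b) - z).re = a - z.re := by simp [gaussToComplex]
    have e2 : (gaussToComplex (a, b) - z).im = b - z.im := by simp [gaussToComplex]
    rw [e1, e2]
    linarith

/-! ### The register: n data qubits, one flag qubit, n clean ancillas -/

/-- The ancillas of the ladder of Toffoli gates. -/
def ladder (n : ℕ) : Finset (Fin n ⊕ Fin (n + 1)) :=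
  Finset.univ.image fun j : Fin n => Sum.inr j.succ

lemma clean_ladder_iff {n : ℕ} (x : Fin n ⊕ Fin (n + 1) → Bool) :
    Clean (ladder n) x ↔ ∀ j : Fin n, x (Sum.inr j.succ) = false := by
  simp [Clean, ladder]

/-- The wire `Sum.inr 0` is traced out at the end but is not clean: it is the flag bit separating
the wanted amplitudes from the filler. The phase is therefore controlled by n + 1 wires. -/
lemma hasTopPhase_ladder {G : Set Gate} (hG : standardGates ⊆ G) (n : ℕ) :
    HasTopPhase G (ladder n) (74 * n + 2) := by
  obtain ⟨d, hd, hd'⟩ := exists_implDiag_and hG (List.ofFn fun i : Fin n => Sum.inl i)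
    (List.ofFn fun j : Fin n => Sum.inr j.succ) (Sum.inr (0 : Fin (n + 1)))
    (by simp) (by
      rw [List.nodup_cons, List.nodup_append]
      refine ⟨?_, List.nodup_ofFn.mpr Sum.inl_injective,
        List.nodup_ofFn.mpr (Sum.inr_injective.comp (Fin.succ_injective n)), ?_⟩
      · simp [Fin.succ_ne_zero]
      · simp)
  refine ⟨d, by simpa using hd, fun x hx => ?_⟩
  rw [clean_ladder_iff] at hx
  have h0 : (Sum.inr 0 : Fin n ⊕ Fin (n + 1)) ∉ ladder n := by simp [ladder, Fin.succ_ne_zero]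
  have hl : ∀ i, (Sum.inl i : Fin n ⊕ Fin (n + 1)) ∉ ladder n := by simp [ladder]
  have key : (x (Sum.inr 0) = true ∧ ∀ w ∈ List.ofFn fun i : Fin n => Sum.inl i, x w = true) ↔
      x = topString (ladder n) := by
    simp only [List.mem_ofFn, forall_exists_index, forall_apply_eq_imp_iff]
    constructor
    · rintro ⟨h1, h2⟩
      funext i
      rcases i with i | i
      · simp [topString, hl, h2]
      · refine Fin.cases ?_ (fun j => ?_) i
        · simp [topString, h0, h1]
        · rw [hx]
          simp [topString, ladder]
    · rintro rfl
      exact ⟨by simp [topString, h0], fun i => by simp [topString, hl]⟩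
  rw [hd' x (by simpa using hx)]
  by_cases h : x = topString (ladder n)
  · rw [if_pos h, if_pos (key.mpr h)]
  · rw [if_neg h, if_neg (mt key.mp h)]

lemma card_clean_le {n : ℕ} (T : Finset (Fin n ⊕ Fin (n + 1) → Bool))
    (hT : ∀ x ∈ T, Clean (ladder n) x) : T.card ≤ 2 ^ (n + 1) := by
  have h := Finset.card_le_card_of_injOn (s := T)
    (t := (Finset.univ : Finset ((Fin n → Bool) × Bool)))
    (fun x => (x ∘ Sum.inl, x (Sum.inr 0))) (fun _ _ => Finset.mem_univ _) (by
      intro x hx y hy hxy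
      simp only [Prod.mk.injEq] at hxy
      have hx' := (clean_ladder_iff x).mp (hT x hx)
      have hy' := (clean_ladder_iff y).mp (hT y hy)
      funext i
      rcases i with i | i
      · exact congrFun hxy.1 i
      · refine Fin.cases hxy.2 (fun j => ?_) i
        rw [hx', hy'])
  simpa [pow_succ] using h

lemma sum_clean {M : Type*} [AddCommMonoid M] {n : ℕ} (f : (Fin (n + 1) → Bool) → M)
    (hf : ∀ b : Fin (n + 1) → Bool, (¬ ∀ j : Fin n, b j.succ = false) → f b = 0) :
    ∑ b, f b = f (Fin.cons false fun _ => false) + f (Fin.cons true fun _ => false) := by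
  have hne : (Fin.cons false fun _ => false : Fin (n + 1) → Bool) ≠ Fin.cons true fun _ => false := by
    intro h
    simpa using congrFun h 0
  rw [← Finset.sum_pair hne]
  symm
  refine Finset.sum_subset (Finset.subset_univ _) fun b _ hb => hf b fun h => hb ?_
  have : b = Fin.cons (b 0) fun _ => false := by
    funext i
    refine Fin.cases rfl (fun j => ?_) i
    rw [h j, Fin.cons_succ]
  rw [this, Finset.mem_insert, Finset.mem_singleton]
  cases b 0
  · exact Or.inl rfl
  · exact Or.inr rfl

/-- The amplitudes `w₀` on the strings with first ancilla `0` and `w₁` on those with first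
ancilla `1`. -/
def joinAmps {n : ℕ} (w₀ w₁ : (Fin n → Bool) → ℤ × ℤ) (z : Fin n ⊕ Fin (n + 1) → Bool) : ℤ × ℤ :=
  if ∀ j : Fin n, z (Sum.inr j.succ) = false then
    if z (Sum.inr 0) then w₁ (z ∘ Sum.inl) else w₀ (z ∘ Sum.inl)
  else 0

lemma joinAmps_false {n : ℕ} (w₀ w₁ : (Fin n → Bool) → ℤ × ℤ) (x : Fin n → Bool) :
    joinAmps w₀ w₁ (Sum.elim x (Fin.cons false fun _ => false)) = w₀ x := by
  simp [joinAmps]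

lemma joinAmps_true {n : ℕ} (w₀ w₁ : (Fin n → Bool) → ℤ × ℤ) (x : Fin n → Bool) :
    joinAmps w₀ w₁ (Sum.elim x (Fin.cons true fun _ => false)) = w₁ x := by
  simp [joinAmps]

lemma joinAmps_eq_zero {n : ℕ} (w₀ w₁ : (Fin n → Bool) → ℤ × ℤ) (x : Fin n → Bool)
    {b : Fin (n + 1) → Bool} (hb : ¬ ∀ j : Fin n, b j.succ = false) :
    joinAmps w₀ w₁ (Sum.elim x b) = 0 :=
  if_neg hb

lemma sum_gaussNorm_joinAmps {n : ℕ} (w₀ w₁ : (Fin n → Bool) → ℤ × ℤ) :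
    ∑ z, gaussNorm (joinAmps w₀ w₁ z) = ∑ x, gaussNorm (w₀ x) + ∑ x, gaussNorm (w₁ x) := by
  rw [← (Equiv.sumArrowEquivProdArrow _ _ Bool).symm.sum_comp, Fintype.sum_prod_type,
    ← Finset.sum_add_distrib]
  refine Finset.sum_congr rfl fun x _ => ?_
  have h := sum_clean (fun b => gaussNorm (joinAmps w₀ w₁ (Sum.elim x b))) fun b hb => by
    rw [joinAmps_eq_zero _ _ _ hb]; rfl
  rw [joinAmps_false, joinAmps_true] at h
  exact h

/-- Lagrange's four squares, stored as two Gaussian integers at two distinct strings; this needs n ≥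
1. -/
lemma exists_gaussNorm_sum_eq {n : ℕ} (hn : 1 ≤ n) (D : ℕ) :
    ∃ w : (Fin n → Bool) → ℤ × ℤ, ∑ x, gaussNorm (w x) = D := by
  obtain ⟨a, b, c, d, h⟩ := Nat.sum_four_squares D
  have hne : (fun _ => false : Fin n → Bool) ≠ fun _ => true := by
    intro h
    simpa using congrFun h ⟨0, hn⟩
  refine ⟨fun x => if x = fun _ => false then (a, b) else if x = fun _ => true then (c, d) else 0, ?_⟩
  rw [← Finset.sum_subset (Finset.subset_univ {fun _ => false, fun _ => true}) ?_,
    Finset.sum_pair hne, ← h]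
  · simp only [if_true, if_neg hne.symm, gaussNorm]
    push_cast
    ring
  · intro x _ hx
    simp only [Finset.mem_insert, Finset.mem_singleton, not_or] at hx
    simp only [if_neg hx.1, if_neg hx.2]
    rfl

/-! ### From amplitude errors to trace norm errors -/

lemma trNorm_le_of_entry_le {X : Type} [Fintype X] [DecidableEq X] [Nonempty X]
    {A : Matrix X X ℂ} (hA : A.IsHermitian) {δ : ℝ} (hδ : 0 ≤ δ) (h : ∀ x y, ‖A x y‖ ≤ δ) :
    trNorm A ≤ (Fintype.card X : ℝ) ^ 2 * δ / 2 := by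
  have h1 : (1 : ℝ) ≤ Fintype.card X := by exact_mod_cast Fintype.card_pos
  refine trNorm_le_of_sum_le hA (by positivity) ?_
  have h2 : ∑ x, ∑ y, ‖A x y‖ ^ 2 ≤ (Fintype.card X : ℝ) ^ 2 * δ ^ 2 := by
    calc ∑ x, ∑ y, ‖A x y‖ ^ 2 ≤ ∑ _x : X, ∑ _y : X, δ ^ 2 :=
          Finset.sum_le_sum fun x _ => Finset.sum_le_sum fun y _ =>
            pow_le_pow_left₀ (norm_nonneg _) (h x y) 2
      _ = _ := by simp; ring
  have h3 : (Fintype.card X : ℝ) ^ 3 ≤ (Fintype.card X : ℝ) ^ 4 :=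
    pow_le_pow_right₀ h1 (by norm_num)
  calc Fintype.card X * ∑ x, ∑ y, ‖A x y‖ ^ 2
      ≤ Fintype.card X * ((Fintype.card X : ℝ) ^ 2 * δ ^ 2) := by gcongr
    _ = (Fintype.card X : ℝ) ^ 3 * δ ^ 2 := by ring
    _ ≤ (Fintype.card X : ℝ) ^ 4 * δ ^ 2 := by gcongr
    _ = _ := by ring

/-- A close approximation of a unit vector `v` by a vector `P`, completed by a vector `Q`. -/
lemma norm_mix_sub_le {X : Type} [Fintype X] {v P Q : X → ℂ} {η : ℝ}
    (hv : ∑ x, ‖v x‖ ^ 2 = 1) (hPQ : ∑ x, ‖P x‖ ^ 2 + ∑ x, ‖Q x‖ ^ 2 = 1)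
    (hη : ∀ x, ‖P x - v x‖ ≤ η) (x y : X) :
    ‖P x * star (P y) + Q x * star (Q y) - v x * star (v y)‖ ≤ 2 * η * (1 + Fintype.card X) := by
  have hle : ∀ f : X → ℂ, ∑ x, ‖f x‖ ^ 2 ≤ 1 → ∀ x, ‖f x‖ ≤ 1 := by
    intro f hf x
    have := Finset.single_le_sum (f := fun x => ‖f x‖ ^ 2) (fun x _ => sq_nonneg _) (Finset.mem_univ x)
    exact (sq_le_one_iff₀ (norm_nonneg _)).mp (this.trans hf)
  have hQ0 : 0 ≤ ∑ x, ‖Q x‖ ^ 2 := Finset.sum_nonneg fun _ _ => sq_nonneg _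
  have hv1 := hle v hv.le
  have hP1 := hle P (by linarith)
  have hη0 : 0 ≤ η := (norm_nonneg _).trans (hη x)
  have h1 : ‖P x * star (P y) - v x * star (v y)‖ ≤ 2 * η := by
    have e : P x * star (P y) - v x * star (v y)
        = P x * star (P y - v y) + (P x - v x) * star (v y) := by rw [star_sub]; ring
    rw [e]
    refine (norm_add_le _ _).trans ?_
    rw [norm_mul, norm_mul, norm_star, norm_star]
    have a1 := mul_le_mul (hP1 x) (hη y) (norm_nonneg _) zero_le_one
    have a2 := mul_le_mul (hη x) (hv1 y) (norm_nonneg _) hη0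
    linarith
  -- The mass of Q is exactly what rounding removed from v, at most 2η per string.
  have h2 : ∑ x, ‖Q x‖ ^ 2 ≤ 2 * η * Fintype.card X := by
    have e : ∑ x, ‖Q x‖ ^ 2 = ∑ x, (‖v x‖ ^ 2 - ‖P x‖ ^ 2) := by
      rw [Finset.sum_sub_distrib]; linarith
    rw [e, mul_comm, ← nsmul_eq_mul, ← Finset.card_univ]
    refine Finset.sum_le_card_nsmul _ _ _ fun x _ => ?_
    have a1 : ‖v x‖ ≤ ‖P x‖ + η := by
      have := norm_sub_norm_le (v x) (P x)
      rw [norm_sub_rev] at this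
      linarith [hη x]
    nlinarith [hv1 x, hP1 x, norm_nonneg (P x), norm_nonneg (v x)]
  have h3 : ‖Q x * star (Q y)‖ ≤ ∑ x, ‖Q x‖ ^ 2 := by
    rw [norm_mul, norm_star]
    have a1 := Finset.single_le_sum (f := fun x => ‖Q x‖ ^ 2) (fun x _ => sq_nonneg _) (Finset.mem_univ x)
    have a2 := Finset.single_le_sum (f := fun x => ‖Q x‖ ^ 2) (fun x _ => sq_nonneg _) (Finset.mem_univ y)
    nlinarith [sq_nonneg (‖Q x‖ - ‖Q y‖)]
  have e : P x * star (P y) + Q x * star (Q y) - v x * star (v y)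
      = (P x * star (P y) - v x * star (v y)) + Q x * star (Q y) := by ring
  rw [e]
  refine (norm_add_le _ _).trans ?_
  linarith

/-- Every state of `n` qubits can be approximated with `O(n 2ⁿ κ)` gates up to `O(8ⁿ / 2 ^ κ)`. -/
theorem exists_circuit_approx {G : Set Gate} (hG : standardGates ⊆ G) {n : ℕ} (hn : 1 ≤ n) (κ : ℕ)
    (ξ : Qustring n) : ∃ C : Circuit G (Fin n ⊕ Fin (n + 1)),
      C.size ≤ (2 * n + 1) + 2 * κ * (2 ^ (n + 1) * (82 * n + 8)) ∧
      trNorm (C.output - ketbra ξ.amp) ≤ 4 * (2 ^ n) ^ 3 / 2 ^ κ := by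
  have hξ : ∑ x, ‖ξ.amp x‖ ^ 2 = 1 := by
    have := EuclideanSpace.norm_sq_eq ξ.1
    rw [ξ.2, one_pow] at this
    exact this.symm
  choose w₀ hw₀ hw₀' using fun x => exists_gauss_round (2 ^ κ * ξ.amp x)
  have hpow : (0 : ℝ) < 2 ^ κ := by positivity
  have hn2 : ‖(2 : ℂ) ^ κ‖ = 2 ^ κ := by rw [norm_pow]; norm_num
  have hsum : ∑ x, gaussNorm (w₀ x) ≤ 2 ^ (2 * κ) := by
    have : ((∑ x, gaussNorm (w₀ x) : ℤ) : ℝ) ≤ 2 ^ (2 * κ) := by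
      push_cast
      calc ∑ x, (gaussNorm (w₀ x) : ℝ) ≤ ∑ x, (2 ^ κ) ^ 2 * ‖ξ.amp x‖ ^ 2 :=
            Finset.sum_le_sum fun x _ => (hw₀ x).trans (by rw [norm_mul, hn2, mul_pow])
        _ = 2 ^ (2 * κ) := by rw [← Finset.mul_sum, hξ, mul_one, ← pow_mul, mul_comm]
    exact_mod_cast this
  -- The filler brings the total norm to 4^κ = 2^(2κ), as exact preparation at level k = 2κ
  -- requires; there the denominator √2^(2κ) is 2^κ.
  obtain ⟨w₁, hw₁⟩ := exists_gaussNorm_sum_eq hn (2 ^ (2 * κ) - ∑ x, gaussNorm (w₀ x)).toNat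
  rw [Int.toNat_of_nonneg (sub_nonneg.mpr hsum)] at hw₁
  obtain ⟨C, hC, u, hu, hCu⟩ := prep_gaussVec hG (hasTopPhase_ladder hG n) (card_clean_le)
    (2 * κ) (joinAmps w₀ w₁)
    (fun z hz => if_neg (by rwa [clean_ladder_iff] at hz))
    (by rw [sum_gaussNorm_joinAmps, hw₁]; ring)
  refine ⟨C, hC.trans (le_of_eq ?_), ?_⟩
  · rw [Fintype.card_sum, Fintype.card_fin, Fintype.card_fin]
    ring
  set P : (Fin n → Bool) → ℂ := fun x => gaussToComplex (w₀ x) / 2 ^ κ with hP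
  set Q : (Fin n → Bool) → ℂ := fun x => gaussToComplex (w₁ x) / 2 ^ κ with hQ
  have hsqrt : ((Real.sqrt 2 : ℝ) : ℂ) ^ (2 * κ) = 2 ^ κ := by
    rw [pow_mul, ← Complex.ofReal_pow, Real.sq_sqrt (by norm_num)]; norm_num
  have hout : ∀ x y, C.output x y = P x * star (P y) + Q x * star (Q y) := by
    intro x y
    have hu2 : ∀ a b : ℂ, (u * a) * star (u * b) = a * star b := by
      intro a b
      have : u * star u = 1 := by
        have := Complex.mul_conj' u
        rw [hu] at this
        simpa using this
      rw [star_mul']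
      linear_combination (a * star b) * this
    rw [C.output_apply, sum_clean _ fun b hb => by
      simp [hCu, gaussVec, joinAmps_eq_zero _ _ _ hb, gaussToComplex]]
    simp only [hCu, Pi.smul_apply, smul_eq_mul, hu2, gaussVec, joinAmps_false, joinAmps_true, hsqrt,
      hP, hQ]
  have hnorm : ∀ z : ℤ × ℤ, ‖gaussToComplex z / 2 ^ κ‖ ^ 2 = gaussNorm z / 2 ^ (2 * κ) := by
    intro z
    rw [norm_div, div_pow, sq_norm_gaussToComplex, hn2, ← pow_mul, mul_comm κ]
  have h1 := norm_mix_sub_le (v := ξ.amp) (P := P) (Q := Q) (η := 2 / 2 ^ κ) hξ (by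
      simp only [hP, hQ, hnorm]
      rw [← Finset.sum_div, ← Finset.sum_div, ← add_div, div_eq_one_iff_eq (by positivity)]
      have : ((∑ x, gaussNorm (w₀ x) + ∑ x, gaussNorm (w₁ x) : ℤ) : ℝ) = (2 ^ (2 * κ) : ℤ) := by
        rw [hw₁]; congr 1; ring
      push_cast at this
      exact this) (by
      intro x
      have e : P x - ξ.amp x = (gaussToComplex (w₀ x) - 2 ^ κ * ξ.amp x) / 2 ^ κ := by
        rw [hP]; field_simp
      rw [e, norm_div, hn2]
      exact div_le_div_of_nonneg_right (hw₀' x) hpow.le)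
  have h2 := trNorm_le_of_entry_le (C.isHermitian_output.sub (isHermitian_ketbra ξ.amp))
    (δ := 2 * (2 / 2 ^ κ) * (1 + Fintype.card (Fin n → Bool))) (by positivity) (fun x y => by
      rw [Matrix.sub_apply, hout]
      exact h1 x y)
  refine h2.trans ?_
  have hcard : (Fintype.card (Fin n → Bool) : ℝ) = 2 ^ n := by simp
  rw [hcard]
  have hN : (1 : ℝ) ≤ 2 ^ n := one_le_pow₀ one_le_two
  rw [le_div_iff₀ hpow]
  have e : ((2 : ℝ) ^ n) ^ 2 * (2 * (2 / 2 ^ κ) * (1 + 2 ^ n)) / 2 * 2 ^ κ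
      = 2 * ((2 : ℝ) ^ n) ^ 2 * (1 + 2 ^ n) := by field_simp
  rw [e]
  nlinarith [sq_nonneg ((2 : ℝ) ^ n)]

/-- The main term is at most 2·2L·2·83n·2^n = 664·nL2^n and the rest at most nL2^n; nL ≥ 800 absorbs
the constant 665. -/
lemma size_bound {n κ : ℕ} {L : ℝ} (hn : 20 ≤ n) (hκ : (κ : ℝ) ≤ 2 * L) (hL : 2 * (n : ℝ) ≤ L) :
    (((2 * n + 1) + 2 * κ * (2 ^ (n + 1) * (82 * n + 8)) : ℕ) : ℝ) ≤ (n : ℝ) ^ 2 * 2 ^ n * L ^ 2 := by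
  have hn' : (20 : ℝ) ≤ n := by exact_mod_cast hn
  have hN : (1 : ℝ) ≤ 2 ^ n := one_le_pow₀ one_le_two
  push_cast
  rw [pow_succ]
  have h1 : (82 * n + 8 : ℝ) ≤ 83 * n := by linarith
  have hLn : 40 ≤ L := by linarith
  have h2 : 2 * (κ : ℝ) * (2 ^ n * 2 * (82 * n + 8)) ≤ 2 * (2 * L) * (2 ^ n * 2 * (83 * n)) := by
    gcongr
  have h3 : (800 : ℝ) ≤ n * L := by nlinarith
  have h4 : (2 * n + 1 : ℝ) ≤ n * L * 2 ^ n := by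
    have : (2 * n + 1 : ℝ) ≤ n * L := by nlinarith
    have h0 : (0 : ℝ) ≤ n * L := by linarith
    nlinarith
  have h5 : (665 : ℝ) * (n * L * 2 ^ n) ≤ (n * L) * (n * L * 2 ^ n) :=
    mul_le_mul_of_nonneg_right (by linarith) (by positivity)
  nlinarith

theorem approximable_of_pos {G : Set Gate} (hG : standardGates ⊆ G) {ε : ℕ → ℝ}
    (hε : ∀ n, 0 < ε n ∧ ε n ≤ 1) (ξ : (n : ℕ) → Qustring n) :
    Approximable G (fun n => n) ξ ε (fun n => (n : ℝ) ^ 2 * 2 ^ n *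
      (Real.logb 2 ((n : ℝ) ^ 2 * 2 ^ (2 * n) / ε n)) ^ 2) := by
  have h : ∀ n, ∃ (p : ℕ) (C : Circuit G (Fin n ⊕ Fin p)), (C.size : ℝ) ≤ (n : ℝ) ^ 2 * 2 ^ n *
      (Real.logb 2 ((n : ℝ) ^ 2 * 2 ^ (2 * n) / ε n)) ^ 2 ∧
      (20 ≤ n → trNorm (C.output - ketbra (ξ n).amp) ≤ ε n) := by
    intro n
    -- Finitely many lengths may fail the error bound, so the empty circuit serves below 20.
    by_cases hn : 20 ≤ n
    · obtain ⟨h0, h1⟩ := hε n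
      set l := Real.logb 2 (1 / ε n) with hl
      have hl0 : 0 ≤ l := Real.logb_nonneg one_lt_two (by rwa [le_div_iff₀ h0, one_mul])
      have hn1 : (1 : ℝ) ≤ (n : ℝ) ^ 2 := one_le_pow₀ (by exact_mod_cast (by omega : 1 ≤ n))
      have hL : 2 * (n : ℝ) + l ≤ Real.logb 2 ((n : ℝ) ^ 2 * 2 ^ (2 * n) / ε n) := by
        rw [Real.le_logb_iff_rpow_le one_lt_two (by positivity), Real.rpow_add two_pos,
          Real.rpow_logb two_pos (by norm_num) (by positivity)]
        have e : (2 : ℝ) ^ (2 * (n : ℝ)) = 2 ^ (2 * n) := by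
          rw [← Real.rpow_natCast]; push_cast; rfl
        rw [e, mul_one_div]
        refine div_le_div_of_nonneg_right ?_ h0.le
        exact le_mul_of_one_le_left (by positivity) hn1
      -- Chosen so that 2^κ ≥ 4·8^n/ε; also κ ≤ 3n + 3 + l ≤ 2(2n + l).
      set κ := ⌈3 * (n : ℝ) + 2 + l⌉₊ with hκ
      obtain ⟨C, hC, hC'⟩ := exists_circuit_approx hG (by omega : 1 ≤ n) κ (ξ n)
      have hn' : (20 : ℝ) ≤ n := by exact_mod_cast hn
      refine ⟨n + 1, C, ?_, fun _ => hC'.trans ?_⟩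
      · refine le_trans (by exact_mod_cast hC) (size_bound hn ?_ (by linarith))
        have := Nat.ceil_lt_add_one (show 0 ≤ 3 * (n : ℝ) + 2 + l by positivity)
        linarith
      · rw [div_le_iff₀ (by positivity)]
        have h2 : 3 * (n : ℝ) + 2 + l ≤ κ := Nat.le_ceil _
        have h3 := Real.rpow_le_rpow_of_exponent_le one_le_two h2
        rw [Real.rpow_natCast, Real.rpow_add two_pos, Real.rpow_add two_pos,
          Real.rpow_logb two_pos (by norm_num) (by positivity)] at h3
        have e : (2 : ℝ) ^ (3 * (n : ℝ)) = (2 ^ n) ^ 3 := by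
          rw [← pow_mul, ← Real.rpow_natCast]; push_cast; rw [mul_comm]
        rw [e, mul_one_div, div_le_iff₀ h0] at h3
        norm_num at h3
        linarith
    · exact ⟨0, ([] : List _), (Nat.cast_zero (R := ℝ)).trans_le (by positivity),
        fun h => absurd h hn⟩
  choose p C hC hC' using h
  exact ⟨p, C, hC, (eventually_ge_atTop 20).mono hC'⟩

end Qu

end

theorem mainTheorem4 (G : Set Qu.Gate) (hfin : G.Finite) (hG : Qu.standardGates ⊆ G) :
    (∀ ε : ℕ → ℝ, (∀ n, 0 < ε n ∧ ε n ≤ 1) → ∀ ξ : (n : ℕ) → Qu.Qustring n,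
      Qu.Approximable G (fun n => n) ξ ε
        (fun n => (n : ℝ) ^ 2 * 2 ^ n * (Real.logb 2 ((n : ℝ) ^ 2 * 2 ^ (2 * n) / ε n)) ^ 2)) ∧
    (∀ ε : ℝ, 0 < ε → ε < 1 → ∀ ℓ : ℕ → ℕ, StrictMono ℓ → 2 ≤ ℓ 0 →
      ∃ ξ : (n : ℕ) → Qu.Qustring (ℓ n), Qu.IsEntanglementEnsemble ℓ ξ ∧
        ∀ s : ℕ → ℕ, (∃ c : ℕ, (fun n => (s n : ℝ)) =O[atTop] fun n => (n : ℝ) ^ c) →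
          ¬ Qu.Approximable G ℓ ξ (fun _ => ε) (fun n => (s n : ℝ))) := by
  exact ⟨fun _ hε ξ => Qu.approximable_of_pos hG hε ξ,
    fun _ h0 h1 _ hℓ hℓ2 => Qu.exists_not_approximable hfin h0 h1 hℓ hℓ2⟩
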